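/- Let $h:\mathbb{C}\setminus\mathbb{R}\to\mathbb{C}$ be a Herglotz--Nevanlinna function, i.e. $h$ is analytic, $h(\overline{\zeta})=\overline{h(\zeta)}$, and $\operatorname{Im} h(\zeta)\ge 0$ for $\operatorname{Im}\zeta>0$. Let $\mathrm{dom}(h)\supseteq\mathbb{C}\setminus\mathbb{R}$ be its maximal domain of analyticity: a real point $x$ belongs to $\mathrm{dom}(h)$ if and only if $h$ continues analytically through an open interval around $x$. The continuation is again denoted by $h$. Let $\mathcal{L}(h)$ be the reproducing kernel Hilbert space of functions on $\mathrm{dom}(h)$ with kernel $$N_h(\zeta,w)=\frac{h(\zeta)-\overline{h(w)}}{\zeta-\overline{w}}\quad(\zeta\neq\overline{w}),\qquad N_h(\overline{w},w)=h'(\overline{w}).$$ For an analytic function $f$ on $\mathrm{dom}(h)$ and $w\in\mathrm{dom}(h)$ put $D_w f(\zeta)=\frac{f(\zeta)-f(w)}{\zeta-w}$ for $\zeta\ne w$ and $D_wf(w)=f'(w)$. Linear relations on $\mathcal{L}(h)$ are linear subspaces of $\mathcal{L}(h)\times\mathcal{L}(h)$. The resolvent set $\varrho(A)$ of a linear relation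 $A$ consists of all $w\in\mathbb{C}$ for which $(A-w)^{-1}=\{(y-wx,x):(x,y)\in A\}$ is the graph of a bounded, everywhere defined operator. Let $$S_h=\{(f,g)\in \mathcal{L}(h)\times\mathcal{L}(h) : g(\zeta)=\zeta f(\zeta)\},\qquad A_h=\{(f,g)\in \mathcal{L}(h)\times\mathcal{L}(h) : g(\zeta)-\zeta f(\zeta)\text{ is constant}\}.$$ A regular extension of $S_h$ is a closed linear relation $\tilde A\supseteq S_h$ on $\mathcal{L}(h)$ with $\varrho(\tilde A)\neq\emptyset$. Finally, let $\mathcal{M}(h)$ be the set of all analytic functions $g:\mathrm{dom}(h)\to\mathbb{C}$ such that $D_w g\in\mathcal{L}(h)$ for all $w\in\mathrm{dom}(h)$. Then $A_h$ is a self-adjoint extension of $S_h$ with $\varrho(A_h)=\mathrm{dom}(h)$ and $(A_h-w)^{-1}f=D_wf$ for all $w\in\varrho(A_h)$ and $f\in\mathcal{L}(h)$, and the following holds. 1. For every $g\in\mathcal{M}(h)\setminus\{0\}$ there is exactly one regular extension $\tilde A$ of $S_h$ such that every $w\in\varrho(A_h)$ with $g(w)\neq 0$ belongs to $\varrho(\tilde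 A)$ and satisfies $$(\tilde A-w)^{-1}f=D_wf-\frac{f(w)}{g(w)}\,D_wg\qquad\text{for all } f\in\mathcal{L}(h).\tag{$*$}$$ 2. Conversely, for every regular extension $\tilde A$ of $S_h$ there is $g\in\mathcal{M}(h)\setminus\{0\}$ such that every $w\in\varrho(A_h)$ with $g(w)\ne0$ belongs to $\varrho(\tilde A)$ and satisfies $(*)$. -/

import Mathlib

open Complex ComplexConjugate Metric Filter Topology

section LinearRelations

variable {H : Type*} [NormedAddCommGroup H] [InnerProductSpace ℂ H]

/-- For a linear relation `A ⊆ H × H`, the relation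
`(A - w)⁻¹ = {(g - w f, f) | (f, g) ∈ A} = {(y, x) | (x, y + w x) ∈ A}`. -/
def LinearRelation.subInv (A : Submodule ℂ (H × H)) (w : ℂ) : Submodule ℂ (H × H) :=
  A.comap ((LinearMap.snd ℂ H H).prod (LinearMap.fst ℂ H H + w • LinearMap.snd ℂ H H))

/-- `(A - w)⁻¹` is (the graph of) the bounded, everywhere defined operator `T`. -/
def LinearRelation.IsResolventAt (A : Submodule ℂ (H × H)) (w : ℂ) (T : H →L[ℂ] H) : Prop :=
  LinearRelation.subInv A w = (T : H →ₗ[ℂ] H).graph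

/-- The resolvent set of a linear relation. -/
def LinearRelation.resolventSet (A : Submodule ℂ (H × H)) : Set ℂ :=
  {w | ∃ T : H →L[ℂ] H, LinearRelation.IsResolventAt A w T}

/-- `B` is a regular extension of `S`: a closed linear relation containing `S`
with nonempty resolvent set. -/
structure LinearRelation.IsRegularExtension (S B : Submodule ℂ (H × H)) : Prop where
  isClosed : IsClosed (B : Set (H × H))
  nonempty : (LinearRelation.resolventSet B).Nonempty
  le : S ≤ B

end LinearRelations

/-- Herglotz-Nevanlinna functions on `ℂ ∖ ℝ`. The values of `toFun` on the real line carry no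
meaning. -/
structure HerglotzNevanlinna where
  toFun : ℂ → ℂ
  differentiableOn : DifferentiableOn ℂ toFun {z | z.im ≠ 0}
  map_conj : ∀ z : ℂ, z.im ≠ 0 → toFun (conj z) = conj (toFun z)
  im_nonneg : ∀ z : ℂ, 0 < z.im → 0 ≤ (toFun z).im

namespace HerglotzNevanlinna

variable (h : HerglotzNevanlinna)

/-- The maximal domain of analyticity `dom h`: all points `ζ` such that `h` restricted to the
nonreal points near `ζ` is the restriction of a function that is analytic at `ζ`. It contains
`ℂ ∖ ℝ`, and a real point belongs to it exactly when `h` continues analytically (from the upper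
to the lower half plane) through an open interval around that point. -/
def domain : Set ℂ :=
  {ζ | ∃ F : ℂ → ℂ, AnalyticAt ℂ F ζ ∧ ∀ᶠ z in 𝓝 ζ, z.im ≠ 0 → F z = h.toFun z}

/-- The analytic continuation of `h` to `dom h` (with irrelevant values outside `dom h`). -/
noncomputable def extension (ζ : ℂ) : ℂ :=
  if ζ.im = 0 then limUnder (𝓝[{z : ℂ | z.im ≠ 0}] ζ) h.toFun else h.toFun ζ

/-- The Nevanlinna kernel `N_h`. -/
noncomputable def nevanlinnaKernel (ζ w : ℂ) : ℂ :=
  if ζ = conj w then deriv h.extension ζ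
  else (h.extension ζ - conj (h.extension w)) / (ζ - conj w)

/-- The Nevanlinna kernel on `dom h`, in the operator-valued form in which Mathlib takes
reproducing kernels. -/
noncomputable def kernelMatrix : Matrix h.domain h.domain (ℂ →L[ℂ] ℂ) :=
  .of fun ζ w => h.nevanlinnaKernel ζ w • (1 : ℂ →L[ℂ] ℂ)

/-! ### The Nevanlinna kernel is positive semidefinite

This is what is needed to construct the space with this kernel. -/

theorem den_ne {ξ ζ : ℂ} (hξ : ‖ξ‖ = 1) (hζ : ζ.im ≠ 0) : ζ * (ξ - 1) + I * (ξ + 1) ≠ 0 := by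
  intro h
  have h1 : ξ * (ζ + I) = ζ - I := by linear_combination h
  have h2 : ‖ζ + I‖ ^ 2 = ‖ζ - I‖ ^ 2 := by
    rw [← h1, norm_mul, hξ, one_mul]
  rw [Complex.sq_norm, Complex.sq_norm, normSq_apply, normSq_apply] at h2
  simp at h2
  apply hζ; linarith

noncomputable def cayleyKernel (ξ ζ : ℂ) : ℂ :=
  I * (ζ * (ξ + 1) + I * (ξ - 1)) / (ζ * (ξ - 1) + I * (ξ + 1))

theorem conj_eq_inv {ξ : ℂ} (hξ : ‖ξ‖ = 1) : conj ξ = ξ⁻¹ := by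
  rw [Complex.inv_def, normSq_eq_norm_sq, hξ]; simp

theorem cayleyKernel_conj {ξ ζ : ℂ} (hξ : ‖ξ‖ = 1) (hζ : ζ.im ≠ 0) : conj (cayleyKernel ξ ζ) = cayleyKernel ξ (conj ζ) := by
  have h0 : ξ ≠ 0 := by rintro rfl; simp at hξ
  have h1 := den_ne hξ hζ
  have h2 := den_ne (ζ := conj ζ) hξ (by simpa using hζ)
  have h3 : conj (ζ * (ξ - 1) + I * (ξ + 1)) ≠ 0 := (map_ne_zero _).2 h1
  unfold cayleyKernel
  rw [map_div₀, div_eq_div_iff h3 h2]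
  simp only [map_mul, map_add, map_sub, conj_I, map_one, conj_eq_inv hξ]
  field_simp
  ring

theorem cayleyKernel_kernel {ξ ζ w : ℂ} (hξ : ‖ξ‖ = 1) (hζ : ζ.im ≠ 0) (hw : w.im ≠ 0) (hne : ζ ≠ conj w) :
    (cayleyKernel ξ ζ - conj (cayleyKernel ξ w)) / (ζ - conj w)
      = 4 * ((ζ * (ξ - 1) + I * (ξ + 1))⁻¹ * conj ((w * (ξ - 1) + I * (ξ + 1))⁻¹)) := by
  have h0 : ξ ≠ 0 := by rintro rfl; simp at hξ
  have h1 := den_ne hξ hζ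
  have h2 := den_ne (ζ := conj w) hξ (by simpa using hw)
  have h3 : conj (w * (ξ - 1) + I * (ξ + 1)) = - ξ⁻¹ * (conj w * (ξ - 1) + I * (ξ + 1)) := by
    simp only [map_mul, map_add, map_sub, conj_I, map_one, conj_eq_inv hξ]
    field_simp
    ring
  have h4 : ζ - conj w ≠ 0 := sub_ne_zero.2 hne
  rw [cayleyKernel_conj hξ hw, map_inv₀, h3]
  unfold cayleyKernel
  rw [div_sub_div _ _ h1 h2]
  field_simp
  ring_nf
  simp only [I_sq]
  ring

theorem cont_cayleyKernel {ζ : ℂ} (hζ : ζ.im ≠ 0) : ContinuousOn (fun ξ => cayleyKernel ξ ζ) (sphere 0 |1|) := by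
  unfold cayleyKernel
  refine ContinuousOn.div (by fun_prop) (by fun_prop) fun ξ hξ => den_ne ?_ hζ
  simpa using hξ

/-- Schwarz formula on the unit disc -/
theorem schwarz {G : ℂ → ℂ} (hG : DifferentiableOn ℂ G (closedBall 0 1)) {z : ℂ} (hz : ‖z‖ < 1) :
    G z = (G 0).re + Real.circleAverage
      (fun ξ => I * ((ξ + z) / (ξ - z)) * ((G ξ).im : ℂ)) 0 1 := by
  have hGd : DiffContOnCl ℂ G (ball 0 |1|) := by
    apply DifferentiableOn.diffContOnCl
    rw [abs_one, closure_ball _ one_ne_zero]; exact hG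
  have hGc : ContinuousOn G (sphere 0 |1|) := by
    rw [abs_one]; exact hG.continuousOn.mono sphere_subset_closedBall
  have hne : ∀ ξ ∈ sphere (0 : ℂ) |1|, ξ - z ≠ 0 := by
    intro ξ hξ h
    have : ξ = z := by linear_combination h
    subst this
    simp at hξ; linarith
  have e1 : Real.circleAverage (fun ξ => (ξ / (ξ - z)) * G ξ) 0 1 = G z := by
    have := hGd.circleAverage_smul_div (w := z) (by simpa using hz)
    simpa using this
  have e0 : Real.circleAverage G 0 1 = G 0 := hGd.circleAverage
  have e2 : Real.circleAverage (fun ξ => ((1 + conj z * ξ) / (1 - conj z * ξ)) * G ξ) 0 1 = G 0 := by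
    have hd : DifferentiableOn ℂ (fun ξ => ((1 + conj z * ξ) / (1 - conj z * ξ)) * G ξ)
        (closedBall 0 1) := by
      refine DifferentiableOn.mul (DifferentiableOn.div (by fun_prop) (by fun_prop) ?_) hG
      intro ξ hξ h
      have h1 : conj z * ξ = 1 := by linear_combination -h
      have h2 : ‖z‖ * ‖ξ‖ = 1 := by
        have := congrArg norm h1
        simpa using this
      have h3 : ‖ξ‖ ≤ 1 := by simpa using hξ
      nlinarith [norm_nonneg z, norm_nonneg ξ]
    have := DiffContOnCl.circleAverage (f := (fun ξ => ((1 + conj z * ξ) / (1 - conj z * ξ)) * G ξ))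
      (c := 0) (R := 1) (by
      apply DifferentiableOn.diffContOnCl
      rw [abs_one, closure_ball _ one_ne_zero]; exact hd)
    simpa using this
  have e3 : Real.circleAverage (fun ξ => ((ξ + z) / (ξ - z)) * conj (G ξ)) 0 1 = conj (G 0) := by
    rw [← e2]
    have hci : CircleIntegrable (fun ξ => ((1 + conj z * ξ) / (1 - conj z * ξ)) * G ξ) 0 1 := by
      apply ContinuousOn.circleIntegrable'
      refine ContinuousOn.mul (ContinuousOn.div (by fun_prop) (by fun_prop) ?_) hGc
      intro ξ hξ h
      have h1 : conj z * ξ = 1 := by linear_combination -h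
      have h2 : ‖z‖ * ‖ξ‖ = 1 := by
        have := congrArg norm h1
        simpa using this
      have h3 : ‖ξ‖ = 1 := by simpa using hξ
      rw [h3] at h2; linarith
    have := ContinuousLinearMap.circleAverage_comp_comm (Complex.conjCLE : ℂ →L[ℝ] ℂ) hci
    simp only [ContinuousLinearEquiv.coe_coe, conjCLE_apply] at this
    rw [← this]
    apply Real.circleAverage_congr_sphere
    intro ξ hξ
    have hξ1 : ‖ξ‖ = 1 := by simpa using hξ
    have h0 : ξ ≠ 0 := by rintro rfl; simp at hξ1
    have := hne ξ hξ
    simp only [Function.comp, conjCLE_apply, map_mul, map_div₀,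
      map_add, map_sub, map_one, conj_conj, conj_eq_inv hξ1]
    congr 1
    have h5 : 1 - z * ξ⁻¹ ≠ 0 := by
      intro h; apply this; field_simp at h; simpa using h
    rw [div_eq_div_iff this h5]
    field_simp
  have hc1 : ContinuousOn (fun ξ => (ξ / (ξ - z)) * G ξ) (sphere 0 |1|) :=
    (ContinuousOn.div (by fun_prop) (by fun_prop) hne).mul hGc
  have hc3 : ContinuousOn (fun ξ => ((ξ + z) / (ξ - z)) * conj (G ξ)) (sphere 0 |1|) :=
    (ContinuousOn.div (by fun_prop) (by fun_prop) hne).mul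
      (Complex.continuous_conj.comp_continuousOn hGc)
  have key : Real.circleAverage (fun ξ => I * ((ξ + z) / (ξ - z)) * ((G ξ).im : ℂ)) 0 1
      = Real.circleAverage (fun ξ => (((ξ / (ξ - z)) * G ξ - (1/2 : ℝ) • G ξ)
        - (1/2 : ℝ) • (((ξ + z) / (ξ - z)) * conj (G ξ)))) 0 1 := by
    apply Real.circleAverage_congr_sphere
    intro ξ hξ
    have := hne ξ hξ
    have him : ((G ξ).im : ℂ) = (G ξ - conj (G ξ)) / (2 * I) := by
      rw [Complex.sub_conj]; field_simp; push_cast; ring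
    simp only [him, Complex.real_smul]
    push_cast
    field_simp
    ring
  have ci1 := hc1.circleIntegrable'
  have ci0 := hGc.circleIntegrable'
  have ci3 := hc3.circleIntegrable'
  rw [key, Real.circleAverage_fun_sub (ContinuousOn.circleIntegrable' (by fun_prop)) 
     (ContinuousOn.circleIntegrable' (by fun_prop)), Real.circleAverage_fun_sub ci1
     (ContinuousOn.circleIntegrable' (by fun_prop)),
     Real.circleAverage_fun_smul, Real.circleAverage_fun_smul, e1, e0, e3]
  simp only [Complex.real_smul]
  rw [Complex.re_eq_add_conj]; push_cast; ring

theorem isOpen_nonreal : IsOpen {z : ℂ | z.im ≠ 0} :=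
  isOpen_ne_fun Complex.continuous_im continuous_const

/-- Cayley transform of the disc of radius `1/r`. -/
noncomputable def cayley (r : ℝ) (z : ℂ) : ℂ := I * (1 + r * z) / (1 - r * z)

theorem cay_den {r : ℝ} (hr : 0 < r) (hr1 : r < 1) {z : ℂ} (hz : ‖z‖ ≤ 1) : 1 - r * z ≠ 0 := by
  intro h0
  have h1 : (r : ℂ) * z = 1 := by linear_combination -h0
  have h2 := congrArg norm h1
  rw [norm_mul, Complex.norm_real, Real.norm_eq_abs, abs_of_pos hr, norm_one] at h2
  nlinarith [norm_nonneg z]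

theorem cay_im {r : ℝ} (hr : 0 < r) (hr1 : r < 1) {z : ℂ} (hz : ‖z‖ ≤ 1) : 0 < (cayley r z).im := by
  have h0 := cay_den hr hr1 hz
  have h2 : z.re ^ 2 + z.im ^ 2 ≤ 1 := by
    have := Complex.sq_norm z
    rw [normSq_apply] at this
    nlinarith [norm_nonneg z]
  have h3 : 0 < normSq (1 - r * z) := normSq_pos.2 h0
  have : (cayley r z).im = (1 - r ^ 2 * (z.re ^ 2 + z.im ^ 2)) / normSq (1 - r * z) := by
    unfold cayley
    rw [Complex.div_im]
    simp only [mul_re, mul_im, I_re, I_im, add_re, add_im, one_re, one_im, sub_re, sub_im,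
      ofReal_re, ofReal_im]
    field_simp
    ring
  rw [this]
  apply div_pos _ h3
  nlinarith

theorem disc_diff {r : ℝ} (hr : 0 < r) (hr1 : r < 1) :
    DifferentiableOn ℂ (fun z => h.toFun (cayley r z)) (closedBall 0 1) := by
  refine h.differentiableOn.comp ?_ ?_
  · unfold cayley
    refine DifferentiableOn.div (by fun_prop) (by fun_prop) ?_
    intro z hz; exact cay_den hr hr1 (by simpa using hz)
  · intro z hz; exact (cay_im hr hr1 (by simpa using hz)).ne'

/-- Approximants of `h` in the upper half plane. -/
noncomputable def approx (r : ℝ) (ζ : ℂ) : ℂ :=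
  if 0 < ζ.im then h.toFun (cayley r ((ζ - I) / (ζ + I)))
  else conj (h.toFun (cayley r ((conj ζ - I) / (conj ζ + I))))

theorem inv_cay_norm {ζ : ℂ} (hζ : 0 < ζ.im) : ζ + I ≠ 0 ∧ ‖(ζ - I) / (ζ + I)‖ < 1 := by
  have h0 : ζ + I ≠ 0 := by
    intro h0
    have := congrArg Complex.im h0
    simp at this; linarith
  refine ⟨h0, ?_⟩
  rw [norm_div, div_lt_one (norm_pos_iff.2 h0)]
  apply lt_of_pow_lt_pow_left₀ 2 (norm_nonneg _)
  rw [Complex.sq_norm, Complex.sq_norm, normSq_apply, normSq_apply]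
  simp
  linarith

theorem approx_upper {r : ℝ} (hr : 0 < r) (hr1 : r < 1) {ζ : ℂ} (hζ : 0 < ζ.im) :
    h.toFun (cayley r ((ζ - I) / (ζ + I))) = (h.toFun (cayley r 0)).re + Real.circleAverage
      (fun ξ => cayleyKernel ξ ζ * ((h.toFun (cayley r ξ)).im : ℂ)) 0 1 := by
  obtain ⟨h0, h1⟩ := inv_cay_norm hζ
  rw [schwarz (h.disc_diff hr hr1) h1]
  congr 1
  apply Real.circleAverage_congr_sphere
  intro ξ hξ
  have hξ1 : ‖ξ‖ = 1 := by simpa using hξ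
  have hd := den_ne hξ1 hζ.ne'
  have hd2 : ξ - (ζ - I) / (ζ + I) ≠ 0 := by
    intro hh; apply hd
    field_simp at hh
    linear_combination hh
  simp only [cayleyKernel]
  congr 1
  have e : ξ - (ζ - I) / (ζ + I) = (ζ * (ξ - 1) + I * (ξ + 1)) / (ζ + I) := by
    field_simp; ring
  rw [e]
  field_simp
  ring

theorem cont_im {r : ℝ} (hr : 0 < r) (hr1 : r < 1) :
    ContinuousOn (fun ξ => ((h.toFun (cayley r ξ)).im : ℂ)) (sphere 0 |1|) := by
  rw [abs_one]
  exact Complex.continuous_ofReal.comp_continuousOn (Complex.continuous_im.comp_continuousOn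
    ((h.disc_diff hr hr1).continuousOn.mono sphere_subset_closedBall))

theorem approx_conj {r : ℝ} {ζ : ℂ} (hζ : ζ.im ≠ 0) :
    h.approx r (conj ζ) = conj (h.approx r ζ) := by
  unfold approx
  rcases lt_or_gt_of_ne hζ with h1 | h1
  · rw [if_pos (by simpa using h1), if_neg (by linarith)]; simp
  · rw [if_neg (by simp; linarith), if_pos h1]; simp

theorem approx_eq {r : ℝ} (hr : 0 < r) (hr1 : r < 1) {ζ : ℂ} (hζ : ζ.im ≠ 0) :
    h.approx r ζ = (h.toFun (cayley r 0)).re + Real.circleAverage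
      (fun ξ => cayleyKernel ξ ζ * ((h.toFun (cayley r ξ)).im : ℂ)) 0 1 := by
  rcases lt_or_gt_of_ne hζ with h1 | h1
  · have h2 : 0 < (conj ζ).im := by simpa using h1
    have hci : CircleIntegrable (fun ξ => cayleyKernel ξ (conj ζ) * ((h.toFun (cayley r ξ)).im : ℂ)) 0 1 :=
      ((cont_cayleyKernel h2.ne').mul (h.cont_im hr hr1)).circleIntegrable'
    have := ContinuousLinearMap.circleAverage_comp_comm (Complex.conjCLE : ℂ →L[ℝ] ℂ) hci
    simp only [ContinuousLinearEquiv.coe_coe, conjCLE_apply] at this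
    unfold approx
    rw [if_neg (by linarith), h.approx_upper hr hr1 h2, map_add, conj_ofReal, ← this]
    congr 1
    apply Real.circleAverage_congr_sphere
    intro ξ hξ
    have hξ1 : ‖ξ‖ = 1 := by simpa using hξ
    simp only [Function.comp, conjCLE_apply, map_mul, conj_ofReal]
    rw [cayleyKernel_conj hξ1 h2.ne', conj_conj]
  · unfold approx
    rw [if_pos h1, h.approx_upper hr hr1 h1]

theorem approx_tendsto {ζ : ℂ} (hζ : ζ.im ≠ 0) :
    Tendsto (fun r => h.approx r ζ) (𝓝[<] 1) (𝓝 (h.toFun ζ)) := by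
  have main : ∀ ζ : ℂ, 0 < ζ.im →
      Tendsto (fun r => h.approx r ζ) (𝓝[<] 1) (𝓝 (h.toFun ζ)) := by
    intro ζ h1
    obtain ⟨h0, h2⟩ := inv_cay_norm h1
    have hI : (2 : ℂ) * I ≠ 0 := by simp
    have e : 1 - (1 : ℂ) * ((ζ - I) / (ζ + I)) = 2 * I / (ζ + I) := by field_simp; ring
    have hc : cayley 1 ((ζ - I) / (ζ + I)) = ζ := by
      unfold cayley
      rw [ofReal_one, e]
      field_simp
      ring
    have hcc : ContinuousAt (fun r : ℝ => cayley r ((ζ - I) / (ζ + I))) 1 := by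
      unfold cayley
      refine ContinuousAt.div (by fun_prop) (by fun_prop) ?_
      rw [ofReal_one, e]
      exact div_ne_zero hI h0
    have hhc : ContinuousAt h.toFun (cayley (1 : ℝ) ((ζ - I) / (ζ + I))) := by
      rw [hc]
      exact (h.differentiableOn.differentiableAt (isOpen_nonreal.mem_nhds h1.ne')).continuousAt
    have := (ContinuousAt.comp (f := fun r : ℝ => cayley r ((ζ - I) / (ζ + I))) hhc hcc).tendsto
    simp only [Function.comp, hc] at this
    refine (this.mono_left nhdsWithin_le_nhds).congr fun r => ?_
    rw [approx, if_pos h1]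
    rfl
  rcases lt_or_gt_of_ne hζ with h1 | h1
  · have h2 : 0 < (conj ζ).im := by simpa using h1
    have := (Complex.continuous_conj.tendsto _).comp (main _ h2)
    rw [h.map_conj _ hζ, conj_conj] at this
    refine this.congr fun r => ?_
    simp only [Function.comp]
    rw [h.approx_conj hζ, conj_conj]
  · exact main ζ h1

theorem psd_generic {ι : Type*} (s : Finset ι) (ζ c : ι → ℂ) (hζ : ∀ j ∈ s, (ζ j).im ≠ 0)
    (hne : ∀ j ∈ s, ∀ k ∈ s, ζ j ≠ conj (ζ k)) :
    0 ≤ (∑ j ∈ s, ∑ k ∈ s, c j * conj (c k) *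
      ((h.toFun (ζ j) - conj (h.toFun (ζ k))) / (ζ j - conj (ζ k)))).re := by
  have lim : Tendsto (fun r => (∑ j ∈ s, ∑ k ∈ s, c j * conj (c k) *
      ((h.approx r (ζ j) - conj (h.approx r (ζ k))) / (ζ j - conj (ζ k)))).re) (𝓝[<] 1)
      (𝓝 (∑ j ∈ s, ∑ k ∈ s, c j * conj (c k) *
      ((h.toFun (ζ j) - conj (h.toFun (ζ k))) / (ζ j - conj (ζ k)))).re) := by
    refine (Complex.continuous_re.tendsto _).comp ?_
    refine tendsto_finsetSum _ fun j hj => tendsto_finsetSum _ fun k hk => ?_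
    refine Tendsto.const_mul _ (Tendsto.div_const (Tendsto.sub (h.approx_tendsto (hζ j hj)) ?_) _)
    exact (Complex.continuous_conj.tendsto _).comp (h.approx_tendsto (hζ k hk))
  refine ge_of_tendsto lim ?_
  filter_upwards [Ioo_mem_nhdsLT (zero_lt_one' ℝ)] with r hr
  obtain ⟨hr, hr1⟩ := hr
  set ρ : ℂ → ℝ := fun ξ => (h.toFun (cayley r ξ)).im with hρ
  have hρc : ContinuousOn (fun ξ => (ρ ξ : ℂ)) (sphere 0 |1|) := h.cont_im hr hr1
  have hPc : ∀ j ∈ s, ContinuousOn (fun ξ => cayleyKernel ξ (ζ j) * (ρ ξ : ℂ)) (sphere 0 |1|) :=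
    fun j hj => (cont_cayleyKernel (hζ j hj)).mul hρc
  have hPc' : ∀ j ∈ s, ContinuousOn (fun ξ => cayleyKernel ξ (conj (ζ j)) * (ρ ξ : ℂ)) (sphere 0 |1|) :=
    fun j hj => (cont_cayleyKernel (by simpa using hζ j hj)).mul hρc
  have term : ∀ j ∈ s, ∀ k ∈ s, c j * conj (c k) *
      ((h.approx r (ζ j) - conj (h.approx r (ζ k))) / (ζ j - conj (ζ k)))
      = Real.circleAverage (fun ξ => (c j * conj (c k) / (ζ j - conj (ζ k))) •
        (cayleyKernel ξ (ζ j) * (ρ ξ : ℂ) - cayleyKernel ξ (conj (ζ k)) * (ρ ξ : ℂ))) 0 1 := by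
    intro j hj k hk
    rw [Real.circleAverage_fun_smul, Real.circleAverage_fun_sub (hPc j hj).circleIntegrable'
      (hPc' k hk).circleIntegrable', ← h.approx_conj (hζ k hk), h.approx_eq hr hr1 (hζ j hj),
      h.approx_eq hr hr1 (by simpa using hζ k hk), smul_eq_mul]
    ring
  have hcont : ∀ j ∈ s, ∀ k ∈ s, ContinuousOn (fun ξ => (c j * conj (c k) / (ζ j - conj (ζ k))) •
        (cayleyKernel ξ (ζ j) * (ρ ξ : ℂ) - cayleyKernel ξ (conj (ζ k)) * (ρ ξ : ℂ))) (sphere 0 |1|) :=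
    fun j hj k hk => ((hPc j hj).sub (hPc' k hk)).fun_const_smul _
  rw [Finset.sum_congr rfl fun j hj => Finset.sum_congr rfl fun k hk => term j hj k hk]
  rw [Finset.sum_congr rfl fun j hj => (Real.circleAverage_fun_sum
    fun k hk => (hcont j hj k hk).circleIntegrable').symm]
  have hcont2 : ∀ j ∈ s, ContinuousOn (fun ξ => ∑ k ∈ s, (c j * conj (c k) / (ζ j - conj (ζ k))) •
        (cayleyKernel ξ (ζ j) * (ρ ξ : ℂ) - cayleyKernel ξ (conj (ζ k)) * (ρ ξ : ℂ))) (sphere 0 |1|) :=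
    fun j hj => continuousOn_finsetSum _ fun k hk => hcont j hj k hk
  rw [← Real.circleAverage_fun_sum fun j hj => (hcont2 j hj).circleIntegrable']
  have hcont3 := (continuousOn_finsetSum s fun j hj => hcont2 j hj).circleIntegrable'
  have hre := ContinuousLinearMap.circleAverage_comp_comm Complex.reCLM hcont3
  simp only [reCLM_apply] at hre
  rw [← hre]
  apply Real.circleAverage_nonneg_of_nonneg
  intro ξ hξ
  have hξ1 : ‖ξ‖ = 1 := by simpa using hξ
  have hρ0 : 0 ≤ ρ ξ := h.im_nonneg _ (cay_im hr hr1 hξ1.le)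
  set u : ℂ := ∑ j ∈ s, c j * (ζ j * (ξ - 1) + I * (ξ + 1))⁻¹ with hu
  have : ∑ j ∈ s, ∑ k ∈ s, (c j * conj (c k) / (ζ j - conj (ζ k))) •
        (cayleyKernel ξ (ζ j) * (ρ ξ : ℂ) - cayleyKernel ξ (conj (ζ k)) * (ρ ξ : ℂ)) = ((4 * ρ ξ * normSq u : ℝ) : ℂ) := by
    push_cast
    rw [← mul_conj u, hu, map_sum, Finset.sum_mul_sum, Finset.mul_sum]
    refine Finset.sum_congr rfl fun j hj => ?_
    rw [Finset.mul_sum]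
    refine Finset.sum_congr rfl fun k hk => ?_
    have := cayleyKernel_kernel hξ1 (hζ j hj) (hζ k hk) (hne j hj k hk)
    rw [cayleyKernel_conj hξ1 (hζ k hk)] at this
    rw [smul_eq_mul, map_mul]
    linear_combination (c j * conj (c k) * ρ ξ) * this
  simp only [Function.comp, reCLM_apply, this, ofReal_re]
  have := normSq_nonneg u
  positivity
theorem neBot_nonreal (ζ : ℂ) : NeBot (𝓝[{z : ℂ | z.im ≠ 0}] ζ) := by
  rw [← mem_closure_iff_nhdsWithin_neBot]
  have : {z : ℂ | z.im ≠ 0} = Complex.im ⁻¹' {0}ᶜ := rfl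
  rw [this, closure_preimage_im]
  simp

theorem extension_of_im_ne_zero {ζ : ℂ} (hζ : ζ.im ≠ 0) : h.extension ζ = h.toFun ζ := if_neg hζ

theorem mem_domain_of_im_ne_zero {ζ : ℂ} (hζ : ζ.im ≠ 0) : ζ ∈ h.domain :=
  ⟨h.toFun, h.differentiableOn.analyticAt (isOpen_nonreal.mem_nhds hζ),
    Eventually.of_forall fun _ _ => rfl⟩

theorem analyticAt_extension {ζ : ℂ} (hζ : ζ ∈ h.domain) : AnalyticAt ℂ h.extension ζ := by
  obtain ⟨F, hF, hFh⟩ := hζ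
  refine hF.congr ?_
  filter_upwards [hF.eventually_analyticAt, hFh.eventually_nhds] with z hz hzh
  by_cases h0 : z.im = 0
  · rw [extension, if_pos h0]
    have := neBot_nonreal z
    symm
    apply Tendsto.limUnder_eq
    refine (hz.continuousAt.tendsto.mono_left nhdsWithin_le_nhds).congr' ?_
    rw [EventuallyEq, eventually_nhdsWithin_iff]
    exact hzh
  · rw [h.extension_of_im_ne_zero h0]
    exact hzh.self_of_nhds h0

theorem isOpen_domain : IsOpen h.domain := by
  rw [isOpen_iff_mem_nhds]
  rintro ζ ⟨F, hF, hFh⟩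
  filter_upwards [hF.eventually_analyticAt, hFh.eventually_nhds] with z hz hzh
  exact ⟨F, hz, hzh⟩

theorem conj_mem_domain {ζ : ℂ} (hζ : ζ ∈ h.domain) : conj ζ ∈ h.domain := by
  by_cases h0 : ζ.im = 0
  · rwa [conj_eq_iff_im.2 h0]
  · exact h.mem_domain_of_im_ne_zero (by simpa using h0)

theorem extension_conj {ζ : ℂ} (hζ : ζ ∈ h.domain) : h.extension (conj ζ) = conj (h.extension ζ) := by
  have := neBot_nonreal ζ
  have t1 : Tendsto (fun z => h.extension (conj z)) (𝓝[{z : ℂ | z.im ≠ 0}] ζ) (𝓝 (h.extension (conj ζ))) :=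
    ((h.analyticAt_extension (h.conj_mem_domain hζ)).continuousAt.tendsto.comp
      (Complex.continuous_conj.tendsto ζ)).mono_left nhdsWithin_le_nhds
  have t2 : Tendsto (fun z => conj (h.extension z)) (𝓝[{z : ℂ | z.im ≠ 0}] ζ) (𝓝 (conj (h.extension ζ))) :=
    ((Complex.continuous_conj.tendsto _).comp
      (h.analyticAt_extension hζ).continuousAt.tendsto).mono_left nhdsWithin_le_nhds
  refine tendsto_nhds_unique (t1.congr' ?_) t2
  filter_upwards [self_mem_nhdsWithin] with z hz
  have hz : z.im ≠ 0 := hz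
  rw [h.extension_of_im_ne_zero hz, h.extension_of_im_ne_zero (by simpa using hz), h.map_conj z hz]

theorem deriv_extension_conj {ζ : ℂ} (hζ : ζ ∈ h.domain) :
    deriv h.extension (conj ζ) = conj (deriv h.extension ζ) := by
  have e : (conj ∘ h.extension ∘ conj) =ᶠ[𝓝 ζ] h.extension := by
    filter_upwards [h.isOpen_domain.mem_nhds hζ] with z hz
    simp [h.extension_conj hz]
  rw [← e.deriv_eq, deriv_conj_conj]
  simp

theorem nevanlinnaKernel_conj (ζ w : h.domain) :
    conj (h.nevanlinnaKernel ζ w) = h.nevanlinnaKernel w ζ := by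
  unfold nevanlinnaKernel
  by_cases h0 : (ζ : ℂ) = conj (w : ℂ)
  · rw [if_pos h0, if_pos (by rw [h0, conj_conj]), ← h.deriv_extension_conj ζ.2, h0, conj_conj]
  · have h1 : (w : ℂ) ≠ conj (ζ : ℂ) := fun h1 => h0 (by rw [h1, conj_conj])
    rw [if_neg h0, if_neg h1, map_div₀, map_sub, map_sub, conj_conj, conj_conj,
      ← neg_div_neg_eq, neg_sub, neg_sub]

theorem tendsto_kernel (ζ w : h.domain) :
    Tendsto (fun ε : ℝ => (h.extension (ζ + I * ε) - conj (h.extension (w + I * ε))) /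
      (ζ + I * ε - conj (w + I * ε))) (𝓝[>] 0) (𝓝 (h.nevanlinnaKernel ζ w)) := by
  have tt : ∀ (x a : ℂ), Tendsto (fun ε : ℝ => x + a * ε) (𝓝[>] 0) (𝓝 x) := by
    intro x a
    have : Continuous fun ε : ℝ => x + a * ε := by fun_prop
    simpa using (this.tendsto 0).mono_left nhdsWithin_le_nhds
  have te : ∀ x : h.domain, Tendsto (fun ε : ℝ => h.extension (x + I * ε)) (𝓝[>] 0) (𝓝 (h.extension x)) :=
    fun x => (h.analyticAt_extension x.2).continuousAt.tendsto.comp (tt x I)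
  unfold nevanlinnaKernel
  by_cases h0 : (ζ : ℂ) = conj (w : ℂ)
  · rw [if_pos h0]
    have hs := (h.analyticAt_extension ζ.2).hasStrictDerivAt
    have hw : (w : ℂ) = conj (ζ : ℂ) := by rw [h0, conj_conj]
    have hp : Tendsto (fun ε : ℝ => ((ζ : ℂ) + I * ε, (ζ : ℂ) + (-I) * ε)) (𝓝[>] 0)
        (𝓝 ((ζ : ℂ), (ζ : ℂ))) := (tt _ _).prodMk_nhds (tt _ _)
    have hlo := hs.isLittleO.comp_tendsto hp
    rw [Asymptotics.isLittleO_iff_tendsto'] at hlo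
    · have := hlo.add_const (deriv h.extension ζ)
      rw [zero_add] at this
      refine this.congr' ?_
      filter_upwards [self_mem_nhdsWithin,
        (tt (w : ℂ) I).eventually (h.isOpen_domain.mem_nhds w.2)] with ε hε hd
      have hε : 0 < ε := hε
      have hε' : (ε : ℂ) ≠ 0 := by exact_mod_cast hε.ne'
      rw [← h.extension_conj hd]
      have e1 : conj ((w : ℂ) + I * ε) = (ζ : ℂ) + (-I) * ε := by
        rw [hw]; simp
      rw [e1]
      have e2 : (ζ : ℂ) + I * ε - (ζ + (-I) * ε) ≠ 0 := by
        have : (ζ : ℂ) + I * ε - (ζ + (-I) * ε) = 2 * I * ε := by ring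
        rw [this]; simp [hε']
      simp only [Function.comp]
      field_simp
      simp
    · filter_upwards [self_mem_nhdsWithin] with ε hε hh
      exfalso
      have hε : 0 < ε := hε
      have hε' : (ε : ℂ) ≠ 0 := by exact_mod_cast hε.ne'
      simp only [Function.comp] at hh
      have : (ζ : ℂ) + I * ε - (ζ + (-I) * ε) = 2 * I * ε := by ring
      rw [this] at hh
      simp [hε'] at hh
  · rw [if_neg h0]
    refine Tendsto.div ((te ζ).sub ((Complex.continuous_conj.tendsto _).comp (te w)))
      ((tt ζ I).sub ((Complex.continuous_conj.tendsto _).comp (tt w I))) (sub_ne_zero.2 h0)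

theorem psd_kernel (s : Finset h.domain) (c : h.domain → ℂ) :
    0 ≤ (∑ j ∈ s, ∑ k ∈ s, c j * conj (c k) * h.nevanlinnaKernel j k).re := by
  have lim : Tendsto (fun ε : ℝ => (∑ j ∈ s, ∑ k ∈ s, c j * conj (c k) *
      ((h.extension (j + I * ε) - conj (h.extension (k + I * ε))) /
        (j + I * ε - conj (k + I * ε)))).re) (𝓝[>] 0)
      (𝓝 (∑ j ∈ s, ∑ k ∈ s, c j * conj (c k) * h.nevanlinnaKernel j k).re) :=
    (Complex.continuous_re.tendsto _).comp (tendsto_finsetSum _ fun j _ =>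
      tendsto_finsetSum _ fun k _ => (h.tendsto_kernel j k).const_mul _)
  refine ge_of_tendsto lim ?_
  have ev1 : ∀ a : ℝ, ∀ᶠ ε : ℝ in 𝓝[>] 0, a + ε ≠ 0 := by
    intro a
    by_cases ha : a = 0
    · subst ha
      filter_upwards [self_mem_nhdsWithin] with ε hε
      rw [zero_add]; exact (Set.mem_Ioi.1 hε).ne'
    · have : Tendsto (fun ε : ℝ => a + ε) (𝓝[>] 0) (𝓝 a) := by
        have hc : Continuous fun ε : ℝ => a + ε := by fun_prop
        simpa using (hc.tendsto 0).mono_left nhdsWithin_le_nhds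
      exact this.eventually_ne ha
  have ev2 : ∀ᶠ ε : ℝ in 𝓝[>] 0, ∀ j ∈ s, (j : ℂ).im + ε ≠ 0 :=
    (Filter.eventually_all_finset s).2 fun j _ => ev1 _
  have ev3 : ∀ᶠ ε : ℝ in 𝓝[>] 0, ∀ j ∈ s, ∀ k ∈ s,
      ((j : ℂ).im + (k : ℂ).im) / 2 + ε ≠ 0 :=
    (Filter.eventually_all_finset s).2 fun j _ => (Filter.eventually_all_finset s).2
      fun k _ => ev1 _
  filter_upwards [ev2, ev3] with ε h2 h3
  have him : ∀ j ∈ s, ((j : ℂ) + I * ε).im ≠ 0 := by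
    intro j hj; simpa using h2 j hj
  have := h.psd_generic s (fun j => (j : ℂ) + I * ε) c him (by
    intro j hj k hk hh
    have := congrArg Complex.im hh
    simp at this
    apply h3 j hj k hk
    linarith)
  refine this.trans_eq (congrArg Complex.re ?_)
  refine Finset.sum_congr rfl fun j hj => Finset.sum_congr rfl fun k hk => ?_
  rw [h.extension_of_im_ne_zero (him _ hj), h.extension_of_im_ne_zero (him _ hk)]

open scoped ComplexOrder in
theorem posSemidef_kernelMatrix : h.kernelMatrix.PosSemidef := by
  have key : h.kernelMatrix.IsHermitian ∧ ∀ v : h.domain →₀ ℂ,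
      0 ≤ RCLike.re (v.sum fun x a => v.sum fun x' a' => inner ℂ (h.kernelMatrix x' x a) a') := by
    refine ⟨?_, fun v => ?_⟩
    · ext ζ w
      simp only [Matrix.conjTranspose_apply, kernelMatrix, Matrix.of_apply, star_smul]
      rw [← h.nevanlinnaKernel_conj w ζ]
      simp
    · refine (h.psd_kernel v.support fun x => conj (v x)).trans_eq (congrArg Complex.re ?_)
      refine Finset.sum_congr rfl fun j _ => Finset.sum_congr rfl fun k _ => ?_
      simp only [kernelMatrix, Matrix.of_apply, ← h.nevanlinnaKernel_conj k j]
      simp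
      ring
  exact (RKHS.posSemidef_tfae.out 0 2).2 key

instance : Fact h.kernelMatrix.PosSemidef := ⟨h.posSemidef_kernelMatrix⟩

/-- The Herglotz space `L(h)`: the reproducing kernel Hilbert space of functions on `dom h`
whose reproducing kernel is the Nevanlinna kernel. Its elements coerce to functions
`dom h → ℂ`. -/
abbrev HerglotzSpace : Type := RKHS.OfKernel h.kernelMatrix

theorem kernel_herglotzSpace : RKHS.kernel h.HerglotzSpace = h.kernelMatrix :=
  RKHS.OfKernel.kernel_ofKernel

/-- Multiplication by the independent variable on `L(h)`, with its maximal domain, as a linear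
relation: all pairs `(f, g)` with `g(ζ) = ζ f(ζ)`. -/
def multiplication : Submodule ℂ (h.HerglotzSpace × h.HerglotzSpace) where
  carrier := {p | ∀ ζ : h.domain, p.2 ζ = ζ * p.1 ζ}
  zero_mem' := by intro ζ; simp
  add_mem' := by
    intro p q hp hq ζ
    simp only [Prod.fst_add, Prod.snd_add, RKHS.coe_add, Pi.add_apply, hp ζ, hq ζ]
    ring
  smul_mem' := by
    intro a p hp ζ
    simp only [Prod.smul_fst, Prod.smul_snd, RKHS.coe_smul, Pi.smul_apply, hp ζ, smul_eq_mul]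
    ring

/-- The linear relation `A_h` of all pairs `(f, g)` in `L(h)` such that `g(ζ) - ζ f(ζ)` is a
constant function. -/
def baseExtension : Submodule ℂ (h.HerglotzSpace × h.HerglotzSpace) where
  carrier := {p | ∃ c : ℂ, ∀ ζ : h.domain, p.2 ζ - ζ * p.1 ζ = c}
  zero_mem' := ⟨0, by intro ζ; simp⟩
  add_mem' := by
    rintro p q ⟨c, hp⟩ ⟨d, hq⟩
    refine ⟨c + d, fun ζ => ?_⟩
    simp only [Prod.fst_add, Prod.snd_add, RKHS.coe_add, Pi.add_apply, ← hp ζ, ← hq ζ]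
    ring
  smul_mem' := by
    rintro a p ⟨c, hp⟩
    refine ⟨a * c, fun ζ => ?_⟩
    simp only [Prod.smul_fst, Prod.smul_snd, RKHS.coe_smul, Pi.smul_apply, ← hp ζ, smul_eq_mul]
    ring

/-- A function on `dom h`, extended by zero to `ℂ`. -/
noncomputable def zeroExtend (f : h.domain → ℂ) : ℂ → ℂ := Function.extend Subtype.val f 0

/-- The difference quotient `D_w f (ζ) = (f(ζ) - f(w)) / (ζ - w)`, with the value `f'(w)` at
`ζ = w`. -/
noncomputable def diffQuot (w : h.domain) (f : h.domain → ℂ) : h.domain → ℂ :=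
  fun ζ => dslope (h.zeroExtend f) w ζ

/-- The set `M(h)` of all analytic functions on `dom h` all of whose difference quotients belong
to `L(h)`. -/
def funcSpaceM : Set (h.domain → ℂ) :=
  {g | AnalyticOnNhd ℂ (h.zeroExtend g) h.domain ∧
    ∀ w : h.domain, ∃ F : h.HerglotzSpace, ⇑F = h.diffQuot w g}

/-- For every `w ∈ dom h` with `g(w) ≠ 0`, the point `w` lies in the resolvent set of `B` and
`(B - w)⁻¹ f = D_w f - (f(w) / g(w)) D_w g` for all `f ∈ L(h)`. -/
def HasResolventFormula (B : Submodule ℂ (h.HerglotzSpace × h.HerglotzSpace))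
    (g : h.domain → ℂ) : Prop :=
  ∀ w : h.domain, g w ≠ 0 → ∃ T : h.HerglotzSpace →L[ℂ] h.HerglotzSpace,
    LinearRelation.IsResolventAt B w T ∧
    ∀ f : h.HerglotzSpace, ⇑(T f) = h.diffQuot w f - (f w / g w) • h.diffQuot w g

end HerglotzNevanlinna

/-!
All relations in question are described through the multiples of one function: for `g` in `M(h)` let
`B_g` (`multipleExtension`) consist of the pairs `(x, y)` such that `y(ζ) - ζ x(ζ)` is a multiple
of `g`. Solving `y(ζ) - (ζ - w) x(ζ) = c g(ζ)` first at `ζ = w` for `c` and then for `x` gives the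
resolvent formula at every `w` with `g(w) ≠ 0`, provided the difference quotient `D_w` is a bounded
operator on `L(h)`. A relation is determined by its resolvent at one point, whence uniqueness.
Conversely, the resolvent of a regular extension at a nonreal point `w` agrees with `D_w` on the
functions vanishing at `w`; so it is `f ↦ D_w f - f(w) φ` for some `φ`, and the extension is `B_g`
with `g(ζ) = 1 + (ζ - w) φ(ζ)`.

It remains to see that `D_w` is bounded, and that `A_h`, whose resolvent it is, is self-adjoint
with resolvent set `dom h`.

* Let `K_v` be the kernel function at `v`. The pairs
  `(K_v - K_u, conj v • K_v - conj u • K_u)` lie in `A_h`, and pairing with them shows that `A_h` is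
  the adjoint of their span (`adjoint_kernelRelation`). The span is thus symmetric, hence bounded
  below after subtraction of a nonreal `w`, and the range is then dense; so the resolvent exists at
  all nonreal points, and `A_h` is self-adjoint.
* At a real point of `dom h`, the spectral theorem is replaced by a growth argument. Let
  `R` be the resolvent at a nonreal `z` such that the disc of radius `ρ` around `z` lies in `dom h`.
  As `R f` is the difference quotient of `f` at `z`, the maximum principle gives
  `|(R ^ n f)(v)| ≤ C (2 / ρ) ^ n ‖f‖`, that is, `‖(R†) ^ n K_v‖ ≤ C (2 / ρ) ^ n` for the adjoint
  `R†`. For a normal operator `n ↦ ‖(R†) ^ n f‖` is log-convex, and such a growth bound on a dense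
  subspace forces `‖R†‖ ≤ 2 / ρ` (`norm_le_of_norm_pow_apply_le`). As `ρ` does not shrink
  when `z` approaches the real point, the Neumann series reaches that point.
* Where the resolvent exists it is analytic, and `h` is recovered from its action on a single `K_v`;
  so `h` continues analytically there (`resolventSet_baseExtension`).
-/

/-! ### Resolvents of linear relations -/

namespace LinearRelation

variable {H : Type*} [NormedAddCommGroup H] [InnerProductSpace ℂ H]

theorem mem_subInv {A : Submodule ℂ (H × H)} {w : ℂ} {x y : H} :
    (y, x) ∈ subInv A w ↔ (x, y + w • x) ∈ A := Iff.rfl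

theorem isResolventAt_iff {A : Submodule ℂ (H × H)} {w : ℂ} {T : H →L[ℂ] H} :
    IsResolventAt A w T ↔ ∀ x y, (x, y + w • x) ∈ A ↔ x = T y := by
  constructor
  · intro hT x y
    rw [← mem_subInv, show subInv A w = _ from hT, LinearMap.mem_graph_iff]
    rfl
  · intro hT
    refine Submodule.ext fun p => ?_
    rw [LinearMap.mem_graph_iff]
    exact hT p.2 p.1

theorem IsResolventAt.apply_mem {A : Submodule ℂ (H × H)} {w : ℂ} {T : H →L[ℂ] H}
    (hT : IsResolventAt A w T) (y : H) : (T y, y + w • T y) ∈ A :=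
  (isResolventAt_iff.1 hT _ _).2 rfl

theorem IsResolventAt.eq_apply {A : Submodule ℂ (H × H)} {w : ℂ} {T : H →L[ℂ] H}
    (hT : IsResolventAt A w T) {x y : H} (hx : (x, y) ∈ A) : x = T (y - w • x) := by
  refine (isResolventAt_iff.1 hT _ _).1 ?_
  simpa using hx

theorem IsResolventAt.unique {A : Submodule ℂ (H × H)} {w : ℂ} {T T' : H →L[ℂ] H}
    (hT : IsResolventAt A w T) (hT' : IsResolventAt A w T') : T = T' := by
  ext y
  exact (isResolventAt_iff.1 hT' _ _).1 (hT.apply_mem y)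

/-- A linear relation is determined by its resolvent at a single point. -/
theorem IsResolventAt.relation_unique {A B : Submodule ℂ (H × H)} {w : ℂ} {T : H →L[ℂ] H}
    (hA : IsResolventAt A w T) (hB : IsResolventAt B w T) : A = B := by
  refine Submodule.ext fun ⟨x, y⟩ => ?_
  have e : y = (y - w • x) + w • x := by simp
  rw [e, isResolventAt_iff.1 hA, isResolventAt_iff.1 hB]

theorem IsResolventAt.isClosed {A : Submodule ℂ (H × H)} {w : ℂ} {T : H →L[ℂ] H}
    (hT : IsResolventAt A w T) : IsClosed (A : Set (H × H)) := by
  have e : (A : Set (H × H)) = {p | p.1 = T (p.2 - w • p.1)} := by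
    ext ⟨x, y⟩
    rw [Set.mem_ofPred_eq, ← isResolventAt_iff.1 hT]
    simp
  rw [e]
  exact isClosed_eq (by fun_prop) (by fun_prop)

/-- The resolvent identity, pointwise. -/
theorem IsResolventAt.apply_sub_apply {A : Submodule ℂ (H × H)} {z w : ℂ} {T T' : H →L[ℂ] H}
    (hT : IsResolventAt A z T) (hT' : IsResolventAt A w T') (y : H) :
    T y - T' y = (z - w) • T (T' y) := by
  have h1 := hT.eq_apply (hT'.apply_mem y)
  have h2 : y + w • T' y - z • T' y = y - (z - w) • T' y := by module
  rw [h2, map_sub, map_smul] at h1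
  nth_rewrite 1 [h1]
  abel

theorem IsResolventAt.commute {A : Submodule ℂ (H × H)} {z w : ℂ} {T T' : H →L[ℂ] H}
    (hT : IsResolventAt A z T) (hT' : IsResolventAt A w T') (y : H) :
    T (T' y) = T' (T y) := by
  by_cases hzw : z = w
  · subst hzw
    rw [hT.unique hT']
  · have h1 := hT.apply_sub_apply hT' y
    have h2 := hT'.apply_sub_apply hT y
    have h3 : (z - w) • (T (T' y) - T' (T y)) = 0 := by
      rw [smul_sub, ← h1]
      have : (z - w) • T' (T y) = - ((w - z) • T' (T y)) := by module
      rw [this, ← h2]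
      abel
    rcases smul_eq_zero.1 h3 with h | h
    · exact absurd (sub_eq_zero.1 h) hzw
    · exact sub_eq_zero.1 h

/-- The Neumann series: the resolvent at a point near `z`. -/
theorem IsResolventAt.neumann [CompleteSpace H] {A : Submodule ℂ (H × H)} {z w : ℂ}
    {T : H →L[ℂ] H} (hT : IsResolventAt A z T) (hw : ‖(w - z) • T‖ < 1) :
    IsResolventAt A w (T * Ring.inverse (1 - (w - z) • T)) := by
  have hu : IsUnit (1 - (w - z) • T) := isUnit_one_sub_of_norm_lt_one hw
  have h1 := Ring.mul_inverse_cancel _ hu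
  have h2 := Ring.inverse_mul_cancel _ hu
  set V := Ring.inverse (1 - (w - z) • T)
  have hV : ∀ y, V y - (w - z) • T (V y) = y := fun y => by
    simpa using congrArg (fun S : H →L[ℂ] H => S y) h1
  have hV' : ∀ y, V (y - (w - z) • T y) = y := fun y => by
    simpa using congrArg (fun S : H →L[ℂ] H => S y) h2
  rw [isResolventAt_iff]
  intro x y
  have e : y + w • x = (y + (w - z) • x) + z • x := by module
  rw [e, isResolventAt_iff.1 hT]
  change x = _ ↔ x = T (V y)
  constructor
  · intro hx
    have h3 : V y = y + (w - z) • x := by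
      rw [← hV' (y + (w - z) • x), ← hx]
      simp
    rw [h3]
    exact hx
  · rintro rfl
    congr 1
    rw [← sub_eq_iff_eq_add]
    exact hV y

theorem norm_sub_smul_lt_one {T : H →L[ℂ] H} {z w : ℂ} (hw : ‖w - z‖ < (‖T‖ + 1)⁻¹) :
    ‖(w - z) • T‖ < 1 := by
  have h1 : 0 < ‖T‖ + 1 := by positivity
  calc ‖(w - z) • T‖ = ‖w - z‖ * ‖T‖ := norm_smul _ _
    _ ≤ ‖w - z‖ * (‖T‖ + 1) := by gcongr; linarith
    _ < (‖T‖ + 1)⁻¹ * (‖T‖ + 1) := by gcongr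
    _ = 1 := inv_mul_cancel₀ h1.ne'

/-- In a neighbourhood of a point of the resolvent set, the resolvent exists and depends
analytically on the point. -/
theorem IsResolventAt.exists_analyticAt [CompleteSpace H] {A : Submodule ℂ (H × H)} {w : ℂ}
    {T : H →L[ℂ] H} (hT : IsResolventAt A w T) :
    ∃ R : ℂ → H →L[ℂ] H, AnalyticAt ℂ R w ∧ ∀ᶠ z in 𝓝 w, IsResolventAt A z (R z) := by
  refine ⟨fun z => T * Ring.inverse (1 - (z - w) • T), ?_, ?_⟩
  · have h1 : AnalyticAt ℂ (fun z : ℂ => 1 - (z - w) • T) w :=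
      analyticAt_const.sub ((analyticAt_id.sub analyticAt_const).smul analyticAt_const)
    have h2 : AnalyticAt ℂ (Ring.inverse : (H →L[ℂ] H) → _) (1 - (w - w) • T) := by
      have := analyticAt_inverse (𝕜 := ℂ) (1 : (H →L[ℂ] H)ˣ)
      simpa using this
    exact analyticAt_const.mul (AnalyticAt.comp (f := fun z : ℂ => 1 - (z - w) • T) h2 h1)
  · filter_upwards [ball_mem_nhds w (inv_pos.2 (by positivity : 0 < ‖T‖ + 1))] with z hz
    exact hT.neumann (norm_sub_smul_lt_one (by simpa [dist_eq_norm] using hz))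

theorem isOpen_resolventSet [CompleteSpace H] (A : Submodule ℂ (H × H)) :
    IsOpen (resolventSet A) := by
  rw [isOpen_iff_mem_nhds]
  rintro w ⟨T, hT⟩
  obtain ⟨R, -, hR⟩ := hT.exists_analyticAt
  filter_upwards [hR] with z hz using ⟨R z, hz⟩

/-- For a symmetric relation, the resolvents at conjugate points are adjoint to each other. -/
theorem IsResolventAt.inner_apply_left {A : Submodule ℂ (H × H)} (hA : A ≤ A.adjoint) {w : ℂ}
    {T T' : H →L[ℂ] H} (hT : IsResolventAt A w T) (hT' : IsResolventAt A (conj w) T') (f g : H) :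
    inner ℂ (T f) g = inner ℂ f (T' g) := by
  have := (Submodule.mem_adjoint_iff _ _).1 (hA (hT'.apply_mem g)) _ _ (hT.apply_mem f)
  simp only [inner_add_left, inner_add_right, inner_smul_left, inner_smul_right] at this
  linear_combination -this

end LinearRelation

/-! ### Normal operators with a dense set of vectors of restricted growth -/

/-- A log-convex sequence of exponential growth at most `q ^ n` satisfies `a 1 ≤ q * a 0`. -/
theorem le_mul_of_logConvex {a : ℕ → ℝ} (ha : ∀ n, 0 ≤ a n)
    (hlc : ∀ n, a (n + 1) ^ 2 ≤ a (n + 2) * a n) {C q : ℝ} (hq : 0 < q)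
    (hC : ∀ n, a n ≤ C * q ^ n) : a 1 ≤ q * a 0 := by
  by_contra! hlt
  have h1 : 0 < a 1 := lt_of_le_of_lt (mul_nonneg hq.le (ha 0)) hlt
  have h0 : 0 < a 0 := by
    refine (ha 0).lt_of_ne fun h0 => ?_
    have := hlc 0
    rw [← h0] at this
    nlinarith
  -- the ratio of consecutive terms is nondecreasing, hence at least `t > q` throughout
  obtain ⟨t, ht⟩ : ∃ t, t = a 1 / a 0 := ⟨_, rfl⟩
  have hqt : q < t := by rw [ht, lt_div_iff₀ h0]; exact hlt
  have ht0 : 0 < t := hq.trans hqt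
  have step : ∀ n, 0 < a n ∧ t * a n ≤ a (n + 1) := by
    intro n
    induction n with
    | zero => exact ⟨h0, by rw [ht]; field_simp; rfl⟩
    | succ n ih =>
      obtain ⟨hp, hle⟩ := ih
      have hp' : 0 < a (n + 1) := lt_of_lt_of_le (mul_pos ht0 hp) hle
      refine ⟨hp', le_of_mul_le_mul_right ?_ hp⟩
      calc t * a (n + 1) * a n = (t * a n) * a (n + 1) := by ring
        _ ≤ a (n + 1) * a (n + 1) := by gcongr
        _ = a (n + 1) ^ 2 := by ring
        _ ≤ a (n + 2) * a n := hlc n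
  have grow : ∀ n, t ^ n * a 0 ≤ a n := by
    intro n
    induction n with
    | zero => simp
    | succ n ih =>
      calc t ^ (n + 1) * a 0 = t * (t ^ n * a 0) := by ring
        _ ≤ t * a n := by gcongr
        _ ≤ a (n + 1) := (step n).2
  obtain ⟨n, hn⟩ := pow_unbounded_of_one_lt (C / a 0) ((one_lt_div hq).2 hqt)
  rw [div_pow, div_lt_div_iff₀ h0 (pow_pos hq n)] at hn
  linarith [grow n, hC n]

/-- If `‖T ^ n f‖` grows at most like `q ^ n` for all `f` in a dense subspace, then the normal
operator `T` has norm at most `q`. -/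
theorem norm_le_of_norm_pow_apply_le {H : Type*} [NormedAddCommGroup H] [InnerProductSpace ℂ H]
    {T T' : H →L[ℂ] H} (hadj : ∀ f g, inner ℂ (T f) g = inner ℂ f (T' g))
    (hcomm : ∀ f, T (T' f) = T' (T f)) {S : Set H} (hS : Dense S) {q : ℝ} (hq : 0 < q)
    (hgrow : ∀ f ∈ S, ∃ C, ∀ n : ℕ, ‖(T ^ n) f‖ ≤ C * q ^ n) : ‖T‖ ≤ q := by
  have hnorm : ∀ f, ‖T' f‖ = ‖T f‖ := by
    intro f
    have e : inner ℂ (T f) (T f) = inner ℂ (T' f) (T' f) := by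
      rw [hadj, ← hcomm, ← inner_conj_symm, hadj, inner_conj_symm]
    rw [inner_self_eq_norm_sq_to_K, inner_self_eq_norm_sq_to_K] at e
    have e' : ‖T f‖ ^ 2 = ‖T' f‖ ^ 2 := by exact_mod_cast e
    exact ((sq_eq_sq₀ (norm_nonneg _) (norm_nonneg _)).1 e').symm
  have hlc : ∀ f, ‖T f‖ ^ 2 ≤ ‖T (T f)‖ * ‖f‖ := by
    intro f
    have e : inner ℂ (T f) (T f) = inner ℂ f (T' (T f)) := hadj f (T f)
    rw [inner_self_eq_norm_sq_to_K] at e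
    have e' := congrArg norm e
    rw [norm_pow, RCLike.norm_ofReal, abs_of_nonneg (norm_nonneg _)] at e'
    rw [e', ← hnorm (T f), mul_comm]
    exact norm_inner_le_norm _ _
  refine T.opNorm_le_bound hq.le fun f => ?_
  refine hS.induction (P := fun f => ‖T f‖ ≤ q * ‖f‖) ?_
    (isClosed_le (by fun_prop) (by fun_prop)) f
  intro f hf
  obtain ⟨C, hC⟩ := hgrow f hf
  have := le_mul_of_logConvex (a := fun n => ‖(T ^ n) f‖) (fun n => norm_nonneg _)
    (fun n => ?_) hq hC
  · simpa using this
  · have := hlc ((T ^ n) f)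
    rw [pow_succ' T (n + 1), pow_succ' T n]
    exact this

/-! ### Kernel vectors and analyticity of the elements of the space -/

theorem dense_span_of_inner_eq_zero {H : Type*} [NormedAddCommGroup H] [InnerProductSpace ℂ H]
    [CompleteSpace H] {s : Set H} (hs : ∀ f, (∀ g ∈ s, inner ℂ g f = 0) → f = 0) :
    Dense (Submodule.span ℂ s : Set H) := by
  rw [Submodule.dense_iff_topologicalClosure_eq_top, Submodule.topologicalClosure_eq_top_iff,
    Submodule.eq_bot_iff]
  exact fun f hf => hs f fun g hg =>
    (Submodule.mem_orthogonal _ f).1 hf g (Submodule.subset_span hg)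

namespace HerglotzNevanlinna

open LinearRelation

variable (h : HerglotzNevanlinna)

/-- The kernel function `N_h(·, v)` as an element of `L(h)`. -/
noncomputable def kerVec (v : h.domain) : h.HerglotzSpace := RKHS.kerFun h.HerglotzSpace v 1

theorem kerVec_apply (v ζ : h.domain) : h.kerVec v ζ = h.nevanlinnaKernel ζ v := by
  rw [kerVec, RKHS.kerFun_apply, h.kernel_herglotzSpace]
  simp [kernelMatrix]

theorem inner_kerVec (v : h.domain) (f : h.HerglotzSpace) : inner ℂ (h.kerVec v) f = f v := by
  rw [kerVec, RKHS.kerFun_inner]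
  simp

theorem norm_apply_le (f : h.HerglotzSpace) (v : h.domain) : ‖f v‖ ≤ ‖h.kerVec v‖ * ‖f‖ := by
  rw [← h.inner_kerVec]
  exact norm_inner_le_norm _ _

theorem continuous_eval (v : h.domain) : Continuous fun f : h.HerglotzSpace => f v :=
  RKHS.continuous_eval v

/-- Point evaluation as a bounded functional on `L(h)`. -/
noncomputable def evalCLM (v : h.domain) : h.HerglotzSpace →L[ℂ] ℂ := innerSL ℂ (h.kerVec v)

theorem evalCLM_apply (v : h.domain) (f : h.HerglotzSpace) : h.evalCLM v f = f v :=
  h.inner_kerVec v f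

theorem zeroExtend_coe (f : h.domain → ℂ) (ζ : h.domain) : h.zeroExtend f ζ = f ζ :=
  Subtype.val_injective.extend_apply _ _ _

theorem zeroExtend_of_mem (f : h.domain → ℂ) {ζ : ℂ} (hζ : ζ ∈ h.domain) :
    h.zeroExtend f ζ = f ⟨ζ, hζ⟩ :=
  h.zeroExtend_coe f ⟨ζ, hζ⟩

theorem extension_sub_eq {ζ w : h.domain} :
    h.extension ζ - conj (h.extension w) = (ζ - conj (w : ℂ)) * h.nevanlinnaKernel ζ w := by
  unfold nevanlinnaKernel
  split_ifs with h0
  · rw [h0, h.extension_conj w.2]; simp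
  · have := sub_ne_zero.2 h0
    field_simp

theorem nevanlinnaKernel_eq_dslope (ζ w : h.domain) :
    h.nevanlinnaKernel ζ w = dslope h.extension (conj (w : ℂ)) ζ := by
  unfold nevanlinnaKernel
  split_ifs with h0
  · rw [h0, dslope_same]
  · rw [dslope_of_ne _ h0, slope_def_field, h.extension_conj w.2]

theorem differentiableOn_extension : DifferentiableOn ℂ h.extension h.domain :=
  fun _ hζ => (h.analyticAt_extension hζ).differentiableAt.differentiableWithinAt

theorem differentiableOn_kerVec (v : h.domain) :
    DifferentiableOn ℂ (h.zeroExtend (h.kerVec v)) h.domain := by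
  refine DifferentiableOn.congr (f := dslope h.extension (conj (v : ℂ))) ?_ fun ζ hζ => ?_
  · exact (Complex.differentiableOn_dslope (h.isOpen_domain.mem_nhds (h.conj_mem_domain v.2))).2
      h.differentiableOn_extension
  · rw [h.zeroExtend_of_mem _ hζ, h.kerVec_apply, h.nevanlinnaKernel_eq_dslope]

theorem norm_kerVec_sq (v : h.domain) : ‖h.kerVec v‖ ^ 2 = ‖h.nevanlinnaKernel v v‖ := by
  rw [← h.kerVec_apply, ← h.inner_kerVec, inner_self_eq_norm_sq_to_K]
  simp

/-- The kernel is locally bounded on the diagonal. At a real point this is the mean value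
inequality for the difference quotient `(h(ζ) - h(conj ζ)) / (ζ - conj ζ)`. -/
theorem exists_norm_kernel_le (w : h.domain) :
    ∃ C : ℝ, ∀ᶠ ζ in 𝓝 (w : ℂ), ∀ hζ : ζ ∈ h.domain,
      ‖h.nevanlinnaKernel (⟨ζ, hζ⟩ : h.domain) (⟨ζ, hζ⟩ : h.domain)‖ ≤ C := by
  have hw := h.analyticAt_extension w.2
  by_cases h0 : (w : ℂ).im = 0
  · have hc : ContinuousAt (fun z => ‖deriv h.extension z‖) (w : ℂ) := hw.deriv.continuousAt.norm
    have hev := (hc.eventually_lt continuousAt_const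
      (lt_add_one ‖deriv h.extension w‖)).and hw.eventually_analyticAt
    obtain ⟨r, hr, hball⟩ := Metric.eventually_nhds_iff_ball.1 hev
    refine ⟨‖deriv h.extension w‖ + 1, ?_⟩
    filter_upwards [ball_mem_nhds (w : ℂ) hr] with ζ hζr hζ
    have hζr' : conj ζ ∈ ball (w : ℂ) r := by
      rw [mem_ball, ← conj_eq_iff_im.2 h0, Complex.dist_conj_conj]
      exact hζr
    unfold nevanlinnaKernel
    split_ifs with h1
    · exact (hball ζ hζr).1.le
    · rw [← h.extension_conj hζ, norm_div, div_le_iff₀ (norm_pos_iff.2 (sub_ne_zero.2 h1))]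
      exact (convex_ball (w : ℂ) r).norm_image_sub_le_of_norm_deriv_le
        (fun z hz => (hball z hz).2.differentiableAt) (fun z hz => (hball z hz).1.le) hζr' hζr
  · have hne : ∀ ζ : ℂ, ζ.im ≠ 0 → ζ - conj ζ ≠ 0 := by
      intro ζ hζ h1
      exact hζ (conj_eq_iff_im.1 (sub_eq_zero.1 h1).symm)
    have hc : ContinuousAt (fun ζ => ‖(h.extension ζ - conj (h.extension ζ)) / (ζ - conj ζ)‖)
        (w : ℂ) := by
      have hh := hw.continuousAt
      refine ContinuousAt.norm (ContinuousAt.div (hh.sub ?_) (by fun_prop) (hne _ h0))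
      exact Complex.continuous_conj.continuousAt.comp hh
    refine ⟨‖(h.extension w - conj (h.extension w)) / (w - conj (w : ℂ))‖ + 1, ?_⟩
    filter_upwards [hc.eventually_lt continuousAt_const (lt_add_one _),
      isOpen_nonreal.mem_nhds h0] with ζ hζ1 hζ2 hζ
    have h1 : ζ ≠ conj ζ := fun h1 => hne ζ hζ2 (sub_eq_zero.2 h1)
    rw [nevanlinnaKernel, if_neg h1]
    exact hζ1.le

/-- Around every point of `dom h` there is a closed disc in `dom h` on which the point
evaluations are uniformly bounded. -/
theorem exists_norm_kerVec_le (w : h.domain) :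
    ∃ r > 0, ∃ C : ℝ, closedBall (w : ℂ) r ⊆ h.domain ∧
      ∀ ζ : h.domain, (ζ : ℂ) ∈ closedBall (w : ℂ) r → ‖h.kerVec ζ‖ ≤ C := by
  obtain ⟨C, hC⟩ := h.exists_norm_kernel_le w
  obtain ⟨r, hr, hball⟩ := Metric.nhds_basis_closedBall.eventually_iff.1
    (hC.and (h.isOpen_domain.eventually_mem w.2))
  refine ⟨r, hr, √C, fun ζ hζ => (hball hζ).2, fun ζ hζ => ?_⟩
  apply Real.le_sqrt_of_sq_le
  rw [h.norm_kerVec_sq]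
  exact (hball hζ).1 ζ.2

theorem dense_span_kerVec :
    Dense (Submodule.span ℂ (Set.range h.kerVec) : Set h.HerglotzSpace) := by
  refine dense_span_of_inner_eq_zero fun f hf => DFunLike.ext _ _ fun v => ?_
  rw [← h.inner_kerVec, hf _ ⟨v, rfl⟩]
  simp

theorem differentiableOn_zeroExtend (f : h.HerglotzSpace) :
    DifferentiableOn ℂ (h.zeroExtend f) h.domain := by
  have hspan : ∀ f ∈ Submodule.span ℂ (Set.range h.kerVec),
      DifferentiableOn ℂ (h.zeroExtend f) h.domain := by
    intro f hf
    induction hf using Submodule.span_induction with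
    | mem f hf => obtain ⟨v, rfl⟩ := hf; exact h.differentiableOn_kerVec v
    | zero =>
      refine (differentiableOn_const (0 : ℂ)).congr fun ζ hζ => ?_
      rw [h.zeroExtend_of_mem _ hζ, RKHS.coe_zero, Pi.zero_apply]
    | add f g _ _ hf hg =>
      refine (hf.add hg).congr fun ζ hζ => ?_
      simp only [Pi.add_apply, h.zeroExtend_of_mem _ hζ, RKHS.coe_add]
    | smul a f _ hf =>
      refine (hf.const_smul a).congr fun ζ hζ => ?_
      simp only [Pi.smul_apply, h.zeroExtend_of_mem _ hζ, RKHS.coe_smul]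
  obtain ⟨F, hF, hFf⟩ := mem_closure_iff_seq_limit.1 (h.dense_span_kerVec f)
  refine TendstoLocallyUniformlyOn.differentiableOn (F := fun n => h.zeroExtend (F n))
    (φ := atTop) ?_ (Eventually.of_forall fun n => hspan _ (hF n)) h.isOpen_domain
  -- norm convergence is uniform convergence where the kernel is bounded
  rw [Metric.tendstoLocallyUniformlyOn_iff]
  intro ε hε w hw
  obtain ⟨r, hr, C, hsub, hC⟩ := h.exists_norm_kerVec_le ⟨w, hw⟩
  refine ⟨closedBall w r, mem_nhdsWithin_of_mem_nhds (closedBall_mem_nhds w hr), ?_⟩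
  have hlim : Tendsto (fun n => C * ‖f - F n‖) atTop (𝓝 0) := by
    have := (tendsto_const_nhds (x := f)).sub hFf
    simpa using this.norm.const_mul C
  filter_upwards [hlim.eventually_lt_const hε] with n hn ζ hζ
  rw [dist_eq_norm, h.zeroExtend_of_mem _ (hsub hζ), h.zeroExtend_of_mem _ (hsub hζ),
    ← Pi.sub_apply, ← RKHS.coe_sub]
  refine (h.norm_apply_le _ _).trans_lt (lt_of_le_of_lt ?_ hn)
  gcongr
  exact hC _ hζ

theorem continuous_coe (f : h.HerglotzSpace) : Continuous f := by
  have := continuousOn_iff_continuous_domRestrict.1 (h.differentiableOn_zeroExtend f).continuousOn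
  refine this.congr fun ζ => ?_
  exact h.zeroExtend_coe f ζ

theorem dense_ne (w : h.domain) : Dense {ζ : h.domain | ζ ≠ w} := by
  have := (dense_compl_singleton (w : ℂ)).preimage h.isOpen_domain.isOpenMap_subtype_val
  refine this.mono fun ζ hζ => ?_
  rintro rfl
  exact hζ rfl

/-- Elements of `L(h)` that agree away from one point are equal. -/
theorem eq_of_forall_ne {f g : h.HerglotzSpace} (w : h.domain) (hfg : ∀ ζ, ζ ≠ w → f ζ = g ζ) :
    f = g := by
  refine DFunLike.coe_injective ((h.continuous_coe f).ext_on (h.dense_ne w)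
    (h.continuous_coe g) fun ζ hζ => hfg ζ hζ)

/-! ### Difference quotients -/

theorem sub_mul_diffQuot (w : h.domain) (f : h.domain → ℂ) (ζ : h.domain) :
    (ζ - w) * h.diffQuot w f ζ = f ζ - f w := by
  have := sub_smul_dslope (h.zeroExtend f) (w : ℂ) ζ
  rwa [smul_eq_mul, h.zeroExtend_coe, h.zeroExtend_coe] at this

/-- An element of `L(h)` is the difference quotient of an analytic function as soon as it
satisfies the defining equation of the quotient; the value at `w` is forced by continuity. -/
theorem eq_diffQuot {w : h.domain} {f : h.domain → ℂ}
    (hf : DifferentiableOn ℂ (h.zeroExtend f) h.domain) {F : h.HerglotzSpace}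
    (hF : ∀ ζ : h.domain, (ζ - w) * F ζ = f ζ - f w) : ⇑F = h.diffQuot w f := by
  have hc : Continuous (h.diffQuot w f) := by
    have := ((Complex.differentiableOn_dslope (h.isOpen_domain.mem_nhds w.2)).2 hf).continuousOn
    exact continuousOn_iff_continuous_domRestrict.1 this
  refine (h.continuous_coe F).ext_on (h.dense_ne w) hc fun ζ hζ => ?_
  have h0 : (ζ : ℂ) - w ≠ 0 := sub_ne_zero.2 fun h1 => hζ (Subtype.ext h1)
  exact mul_left_cancel₀ h0 ((hF ζ).trans (h.sub_mul_diffQuot w f ζ).symm)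

/-! ### The relation `A_h` at nonreal points -/

/-- The part of `A_h` spanned by the pairs `(K_v - K_u, conj v • K_v - conj u • K_u)` of
differences of kernel functions. Its adjoint is `A_h`, see `adjoint_kernelRelation`. -/
noncomputable def kernelRelation : Submodule ℂ (h.HerglotzSpace × h.HerglotzSpace) :=
  Submodule.span ℂ (Set.range fun p : h.domain × h.domain =>
    (h.kerVec p.1 - h.kerVec p.2, conj (p.1 : ℂ) • h.kerVec p.1 - conj (p.2 : ℂ) • h.kerVec p.2))

theorem kernelRelation_le : h.kernelRelation ≤ h.baseExtension := by
  refine Submodule.span_le.2 ?_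
  rintro _ ⟨⟨v, u⟩, rfl⟩
  refine ⟨conj (h.extension v) - conj (h.extension u), fun ζ => ?_⟩
  simp only [RKHS.coe_sub, RKHS.coe_smul, Pi.sub_apply, Pi.smul_apply, smul_eq_mul, h.kerVec_apply]
  linear_combination (-1 : ℂ) * h.extension_sub_eq (ζ := ζ) (w := u) +
    h.extension_sub_eq (ζ := ζ) (w := v)

/-- Pairing with `K_v - K_u` compares the values of `g(ζ) - ζ f(ζ)` at `v` and `u`. -/
theorem adjoint_kernelRelation : h.kernelRelation.adjoint = h.baseExtension := by
  refine Submodule.ext fun x => ?_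
  have key : ∀ v u : h.domain,
      inner ℂ (conj (v : ℂ) • h.kerVec v - conj (u : ℂ) • h.kerVec u) x.1 -
      inner ℂ (h.kerVec v - h.kerVec u) x.2 = (x.2 u - u * x.1 u) - (x.2 v - v * x.1 v) := by
    intro v u
    simp only [inner_sub_left, inner_smul_left, h.inner_kerVec, conj_conj]
    ring
  rw [Submodule.mem_adjoint_iff]
  constructor
  · intro hx
    have hI : I ∈ h.domain := h.mem_domain_of_im_ne_zero (by simp)
    refine ⟨x.2 ⟨I, hI⟩ - I * x.1 ⟨I, hI⟩, fun ζ => ?_⟩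
    have := hx _ _ (Submodule.subset_span ⟨(⟨I, hI⟩, ζ), rfl⟩)
    rw [key] at this
    exact sub_eq_zero.1 this
  · rintro ⟨c, hc⟩ a b hab
    suffices h.kernelRelation ≤ LinearMap.ker ((innerSL ℂ x.1 : h.HerglotzSpace →ₗ[ℂ] ℂ) ∘ₗ
        LinearMap.snd ℂ _ _ - (innerSL ℂ x.2 : h.HerglotzSpace →ₗ[ℂ] ℂ) ∘ₗ
        LinearMap.fst ℂ _ _) by
      have := congrArg conj (LinearMap.mem_ker.1 (this hab))
      simpa using this
    refine Submodule.span_le.2 ?_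
    rintro _ ⟨⟨v, u⟩, rfl⟩
    have := congrArg conj (key v u)
    rw [hc, hc, sub_self, map_sub, inner_conj_symm, inner_conj_symm, map_zero] at this
    exact this

theorem adjoint_baseExtension_le : h.baseExtension.adjoint ≤ h.baseExtension := by
  intro x hx
  rw [← h.adjoint_kernelRelation]
  rw [Submodule.mem_adjoint_iff] at hx ⊢
  exact fun a b hab => hx a b (h.kernelRelation_le hab)

/-- The resolvent equation forces the resolvent of `A_h` at `w ∈ dom h` to be `D_w`. -/
theorem sub_mul_resolvent {w : h.domain} {T : h.HerglotzSpace →L[ℂ] h.HerglotzSpace}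
    (hT : IsResolventAt h.baseExtension w T) (f : h.HerglotzSpace) (ζ : h.domain) :
    (ζ - w) * T f ζ = f ζ - f w := by
  obtain ⟨c, hc⟩ := hT.apply_mem f
  simp only [RKHS.coe_add, RKHS.coe_smul, Pi.add_apply, Pi.smul_apply, smul_eq_mul] at hc
  linear_combination hc w - hc ζ

theorem isResolventAt_of_sub_mul {w : h.domain} {T : h.HerglotzSpace →L[ℂ] h.HerglotzSpace}
    (hT : ∀ (f : h.HerglotzSpace) (ζ : h.domain), (ζ - w) * T f ζ = f ζ - f w) :
    IsResolventAt h.baseExtension w T := by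
  rw [isResolventAt_iff]
  intro x y
  constructor
  · rintro ⟨c, hc⟩
    simp only [RKHS.coe_add, RKHS.coe_smul, Pi.add_apply, Pi.smul_apply, smul_eq_mul] at hc
    refine h.eq_of_forall_ne w fun ζ hζ => ?_
    have h0 : (ζ : ℂ) - w ≠ 0 := sub_ne_zero.2 fun h1 => hζ (Subtype.ext h1)
    apply mul_left_cancel₀ h0
    rw [hT]
    linear_combination hc w - hc ζ
  · rintro rfl
    refine ⟨y w, fun ζ => ?_⟩
    simp only [RKHS.coe_add, RKHS.coe_smul, Pi.add_apply, Pi.smul_apply, smul_eq_mul]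
    linear_combination -hT y ζ

/-- The map `(f, g) ↦ g - w f` on the span of differences of kernel functions. -/
noncomputable def kernelRange (w : ℂ) : h.kernelRelation →ₗ[ℂ] h.HerglotzSpace :=
  (LinearMap.snd ℂ _ _ - w • LinearMap.fst ℂ _ _) ∘ₗ h.kernelRelation.subtype

theorem kernelRange_apply (w : ℂ) (p : h.kernelRelation) :
    h.kernelRange w p = p.1.2 - w • p.1.1 := rfl

theorem denseRange_kernelRange (w : h.domain) : DenseRange (h.kernelRange w) := by
  have hw := h.conj_mem_domain w.2
  -- the range contains `K_v` for all `v ≠ conj w`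
  have hd := dense_span_of_inner_eq_zero (s := {g | ∃ v : h.domain, v ≠ ⟨_, hw⟩ ∧ g = h.kerVec v})
    (fun f hf => h.eq_of_forall_ne ⟨_, hw⟩ fun v hv => by
      rw [← h.inner_kerVec, hf _ ⟨v, hv, rfl⟩, RKHS.coe_zero, Pi.zero_apply])
  rw [DenseRange, ← LinearMap.coe_range]
  refine hd.mono (Submodule.span_le.2 ?_)
  rintro _ ⟨v, hv, rfl⟩
  have h0 : conj (v : ℂ) - w ≠ 0 := sub_ne_zero.2 fun h1 => hv (Subtype.ext (by
    simpa using congrArg conj h1))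
  refine ⟨(conj (v : ℂ) - w)⁻¹ • ⟨_, Submodule.subset_span ⟨(v, ⟨_, hw⟩), rfl⟩⟩, ?_⟩
  rw [map_smul, inv_smul_eq_iff₀ h0, kernelRange_apply]
  simp only [conj_conj]
  module

theorem kernelRelation_symm {p q : h.HerglotzSpace × h.HerglotzSpace} (hp : p ∈ h.kernelRelation)
    (hq : q ∈ h.baseExtension) : inner ℂ p.2 q.1 = inner ℂ p.1 q.2 := by
  rw [← h.adjoint_kernelRelation, Submodule.mem_adjoint_iff] at hq
  exact sub_eq_zero.1 (hq _ _ hp)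

/-- A symmetric relation minus a nonreal `w` is bounded below by `|Im w|`. -/
theorem norm_fst_le {w : ℂ} (hw : w.im ≠ 0) (p : h.kernelRelation) :
    ‖p.1.1‖ ≤ |w.im|⁻¹ * ‖h.kernelRange w p‖ := by
  have hs := h.kernelRelation_symm p.2 (h.kernelRelation_le p.2)
  have h1 : (inner ℂ p.1.1 p.1.2).im = 0 := by
    rw [← conj_eq_iff_im, inner_conj_symm, hs]
  have h2 : inner ℂ p.1.1 (h.kernelRange w p) = inner ℂ p.1.1 p.1.2 - w * (‖p.1.1‖ ^ 2 : ℝ) := by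
    rw [kernelRange_apply, inner_sub_right, inner_smul_right, inner_self_eq_norm_sq_to_K]
    simp
  have h3 : (inner ℂ p.1.1 (h.kernelRange w p)).im = - (w.im * ‖p.1.1‖ ^ 2) := by
    rw [h2, sub_im, h1, im_mul_ofReal, zero_sub]
  have h4 : |w.im| * ‖p.1.1‖ ^ 2 ≤ ‖p.1.1‖ * ‖h.kernelRange w p‖ := by
    calc |w.im| * ‖p.1.1‖ ^ 2 = |(inner ℂ p.1.1 (h.kernelRange w p)).im| := by
          rw [h3, abs_neg, abs_mul, abs_of_nonneg (sq_nonneg ‖p.1.1‖)]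
      _ ≤ ‖inner ℂ p.1.1 (h.kernelRange w p)‖ := abs_im_le_norm _
      _ ≤ _ := norm_inner_le_norm _ _
  have hpos : 0 < |w.im| := abs_pos.2 hw
  rw [inv_mul_eq_div, le_div_iff₀ hpos]
  rcases (norm_nonneg p.1.1).eq_or_lt with h5 | h5
  · rw [← h5, zero_mul]; exact norm_nonneg _
  · refine le_of_mul_le_mul_left ?_ h5
    linarith

theorem exists_resolvent_of_im_ne_zero {w : ℂ} (hw : w.im ≠ 0) :
    ∃ T, IsResolventAt h.baseExtension w T := by
  obtain ⟨v, rfl⟩ : ∃ v : h.domain, (v : ℂ) = w := ⟨⟨w, h.mem_domain_of_im_ne_zero hw⟩, rfl⟩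
  let T := (LinearMap.fst ℂ h.HerglotzSpace h.HerglotzSpace ∘ₗ
    h.kernelRelation.subtype).extendOfNorm (h.kernelRange v)
  have hT : ∀ p, T (h.kernelRange v p) = p.1.1 :=
    LinearMap.extendOfNorm_eq (h.denseRange_kernelRange v) ⟨_, h.norm_fst_le hw⟩
  refine ⟨T, h.isResolventAt_of_sub_mul fun f ζ => ?_⟩
  refine (h.denseRange_kernelRange v).induction_on
    (p := fun f => (ζ - v) * T f ζ = f ζ - f v) f ?_ fun p => ?_
  · exact isClosed_eq (continuous_const.mul ((h.continuous_eval ζ).comp T.continuous))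
      ((h.continuous_eval ζ).sub (h.continuous_eval v))
  · obtain ⟨c, hc⟩ := h.kernelRelation_le p.2
    rw [hT, kernelRange_apply]
    simp only [RKHS.coe_sub, RKHS.coe_smul, Pi.sub_apply, Pi.smul_apply, smul_eq_mul]
    linear_combination hc v - hc ζ

theorem baseExtension_le_adjoint : h.baseExtension ≤ h.baseExtension.adjoint := by
  intro q hq
  rw [Submodule.mem_adjoint_iff]
  intro a b hab
  have hI : I ∈ h.domain := h.mem_domain_of_im_ne_zero (by simp)
  obtain ⟨T, hT⟩ := h.exists_resolvent_of_im_ne_zero (w := I) (by simp)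
  have key : ∀ f, inner ℂ (f + I • T f) q.1 - inner ℂ (T f) q.2 = 0 := by
    intro f
    refine (h.denseRange_kernelRange ⟨I, hI⟩).induction_on
      (p := fun f => inner ℂ (f + I • T f) q.1 - inner ℂ (T f) q.2 = 0) f ?_ fun p => ?_
    · exact isClosed_eq (((continuous_id.add (T.continuous.const_smul I)).inner
        continuous_const).sub (T.continuous.inner continuous_const)) continuous_const
    · have h1 := hT.eq_apply (h.kernelRelation_le p.2)
      rw [kernelRange_apply]
      simp only
      rw [← h1, sub_add_cancel, h.kernelRelation_symm p.2 hq, sub_self]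
  have := key (b - I • a)
  rwa [← hT.eq_apply hab, sub_add_cancel] at this

theorem adjoint_baseExtension : h.baseExtension.adjoint = h.baseExtension :=
  le_antisymm h.adjoint_baseExtension_le h.baseExtension_le_adjoint

/-! ### The resolvent set of `A_h` -/

/-- If `closedBall z ρ` lies in `dom h`, the difference quotient at `z` is bounded by `2 / ρ` times
a bound of the function on the disc and at one further point `v`: outside the disc this is clear
from the definition, and inside it is the maximum principle. -/
theorem norm_resolvent_apply_le {z : h.domain} {R : h.HerglotzSpace →L[ℂ] h.HerglotzSpace}
    (hR : IsResolventAt h.baseExtension z R) {ρ : ℝ} (hρ : 0 < ρ)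
    (hsub : closedBall (z : ℂ) ρ ⊆ h.domain) (v : h.domain) {f : h.HerglotzSpace} {M : ℝ}
    (hM : ∀ ζ : h.domain, (ζ : ℂ) ∈ closedBall (z : ℂ) ρ ∨ ζ = v → ‖f ζ‖ ≤ M) (ζ : h.domain)
    (hζ : (ζ : ℂ) ∈ closedBall (z : ℂ) ρ ∨ ζ = v) : ‖R f ζ‖ ≤ 2 / ρ * M := by
  have hfar : ∀ ζ : h.domain, (ζ : ℂ) ∈ closedBall (z : ℂ) ρ ∨ ζ = v → ρ ≤ ‖(ζ : ℂ) - z‖ →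
      ‖R f ζ‖ ≤ 2 / ρ * M := by
    intro ζ hζ hd
    have h1 : ‖(ζ : ℂ) - z‖ * ‖R f ζ‖ ≤ M + M := by
      rw [← norm_mul, h.sub_mul_resolvent hR]
      exact (norm_sub_le _ _).trans (add_le_add (hM _ hζ)
        (hM _ (Or.inl (mem_closedBall_self hρ.le))))
    rw [div_mul_eq_mul_div, le_div_iff₀ hρ]
    calc ‖R f ζ‖ * ρ ≤ ‖R f ζ‖ * ‖(ζ : ℂ) - z‖ := by gcongr
      _ ≤ 2 * M := by linarith
  rcases le_or_gt ρ ‖(ζ : ℂ) - z‖ with hd | hd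
  · exact hfar ζ hζ hd
  · have hball : (ζ : ℂ) ∈ closedBall (z : ℂ) ρ := by
      rw [mem_closedBall, dist_eq_norm]; exact hd.le
    rw [← h.zeroExtend_coe (R f) ζ]
    refine Complex.norm_le_of_forall_mem_frontier_norm_le (U := ball (z : ℂ) ρ) isBounded_ball
      (((h.differentiableOn_zeroExtend (R f)).mono ?_).diffContOnCl) (fun x hx => ?_)
      (by rwa [closure_ball _ hρ.ne'])
    · rwa [closure_ball _ hρ.ne']
    · rw [frontier_ball _ hρ.ne', mem_sphere, dist_eq_norm] at hx
      have hx' : x ∈ closedBall (z : ℂ) ρ := by rw [mem_closedBall, dist_eq_norm]; exact hx.le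
      rw [h.zeroExtend_of_mem _ (hsub hx')]
      exact hfar _ (Or.inl hx') hx.ge

/-- The norm of the resolvent is controlled by the radius of a disc in `dom h`, not only by the
distance to the real line. The bound for the disc around `z` is obtained for the resolvent `R'` at
`conj z`, because the powers of its adjoint are iterated difference quotients at `z`. -/
theorem norm_resolvent_le {z : h.domain} {R R' : h.HerglotzSpace →L[ℂ] h.HerglotzSpace}
    (hR : IsResolventAt h.baseExtension z R)
    (hR' : IsResolventAt h.baseExtension (conj (z : ℂ)) R') {ρ C : ℝ} (hρ : 0 < ρ)
    (hsub : closedBall (z : ℂ) ρ ⊆ h.domain)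
    (hC : ∀ ζ : h.domain, (ζ : ℂ) ∈ closedBall (z : ℂ) ρ → ‖h.kerVec ζ‖ ≤ C) :
    ‖R'‖ ≤ 2 / ρ := by
  have hR'' : IsResolventAt h.baseExtension (conj (conj (z : ℂ))) R := by rwa [conj_conj]
  have hadj := hR'.inner_apply_left h.baseExtension_le_adjoint hR''
  have hpow : ∀ (n : ℕ) (f g : h.HerglotzSpace),
      inner ℂ ((R' ^ n) f) g = inner ℂ f ((R ^ n) g) := by
    intro n
    induction n with
    | zero => intro f g; rfl
    | succ n ih =>
      intro f g
      have e1 : (R' ^ (n + 1)) f = R' ((R' ^ n) f) := by rw [pow_succ']; rfl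
      have e2 : (R ^ (n + 1)) g = (R ^ n) (R g) := by rw [pow_succ]; rfl
      rw [e1, e2, hadj, ih]
  refine norm_le_of_norm_pow_apply_le hadj (hR'.commute hR) h.dense_span_kerVec (by positivity) ?_
  intro f hf
  induction hf using Submodule.span_induction with
  | mem f hf =>
    obtain ⟨v, rfl⟩ := hf
    have hvals : ∀ (g : h.HerglotzSpace) (n : ℕ) (ζ : h.domain),
        (ζ : ℂ) ∈ closedBall (z : ℂ) ρ ∨ ζ = v →
        ‖(R ^ n) g ζ‖ ≤ (2 / ρ) ^ n * (max C ‖h.kerVec v‖ * ‖g‖) := by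
      intro g n
      induction n with
      | zero =>
        intro ζ hζ
        rw [pow_zero, pow_zero, one_mul]
        refine (h.norm_apply_le g ζ).trans ?_
        gcongr
        rcases hζ with hζ | rfl
        · exact (hC ζ hζ).trans (le_max_left _ _)
        · exact le_max_right _ _
      | succ n ih =>
        intro ζ hζ
        have e : (R ^ (n + 1)) g = R ((R ^ n) g) := by rw [pow_succ']; rfl
        rw [e, pow_succ', mul_assoc]
        exact h.norm_resolvent_apply_le hR hρ hsub v ih ζ hζ
    refine ⟨max C ‖h.kerVec v‖, fun n => ?_⟩
    have hpos : 0 ≤ max C ‖h.kerVec v‖ := (norm_nonneg _).trans (le_max_right _ _)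
    set f := (R' ^ n) (h.kerVec v) with hf
    have h1 : ‖f‖ ^ 2 ≤ (2 / ρ) ^ n * (max C ‖h.kerVec v‖ * ‖f‖) := by
      have e : (‖f‖ : ℂ) ^ 2 = (R ^ n) f v := by
        rw [← h.inner_kerVec, ← hpow n, ← hf, inner_self_eq_norm_sq_to_K]; rfl
      have e' := congrArg norm e
      rw [norm_pow, norm_real, norm_norm] at e'
      rw [e']
      exact hvals f n v (Or.inr rfl)
    rcases (norm_nonneg f).eq_or_lt with h2 | h2
    · rw [← h2]; positivity
    · refine le_of_mul_le_mul_right ?_ h2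
      calc ‖f‖ * ‖f‖ = ‖f‖ ^ 2 := by ring
        _ ≤ _ := h1
        _ = _ := by ring
  | zero => exact ⟨0, fun n => by simp⟩
  | add f g _ _ hf hg =>
    obtain ⟨a, ha⟩ := hf
    obtain ⟨b, hb⟩ := hg
    refine ⟨a + b, fun n => ?_⟩
    rw [map_add, add_mul]
    exact (norm_add_le _ _).trans (add_le_add (ha n) (hb n))
  | smul c f _ hf =>
    obtain ⟨a, ha⟩ := hf
    refine ⟨‖c‖ * a, fun n => ?_⟩
    rw [map_smul, norm_smul, mul_assoc]
    exact mul_le_mul_of_nonneg_left (ha n) (norm_nonneg _)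

theorem exists_resolvent (w : h.domain) : ∃ T, IsResolventAt h.baseExtension w T := by
  by_cases hw : (w : ℂ).im = 0
  · obtain ⟨r, hr, C, hsub, hC⟩ := h.exists_norm_kerVec_le w
    -- a nonreal point `z` at distance `r / 8` from `w`; the bound `2 / (r / 2)` for its resolvent
    -- makes the Neumann series converge at `w`
    have hnorm : ∀ a : ℝ, ‖(a : ℂ) * I‖ = |a| := by simp
    have hball : closedBall ((w : ℂ) - (r / 8 : ℝ) * I) (r / 2) ⊆ closedBall (w : ℂ) r := by
      apply closedBall_subset_closedBall'
      rw [dist_eq_norm, sub_sub_cancel_left, norm_neg, hnorm, abs_of_pos (by positivity)]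
      linarith
    have him : ((w : ℂ) - (r / 8 : ℝ) * I).im ≠ 0 := by
      simp [hw, hr.ne']
    obtain ⟨R, hR⟩ := h.exists_resolvent_of_im_ne_zero him
    have him' : (conj ((w : ℂ) - (r / 8 : ℝ) * I)).im ≠ 0 := by
      simpa only [conj_im, neg_ne_zero] using him
    obtain ⟨R', hR'⟩ := h.exists_resolvent_of_im_ne_zero him'
    have hle := h.norm_resolvent_le (z := ⟨_, h.mem_domain_of_im_ne_zero him⟩) hR hR'
      (half_pos hr) (hball.trans hsub) fun ζ hζ => hC ζ (hball hζ)
    refine ⟨_, hR'.neumann ?_⟩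
    have e : (w : ℂ) - conj ((w : ℂ) - (r / 8 : ℝ) * I) = ((-(r / 8) : ℝ) : ℂ) * I := by
      rw [map_sub, map_mul, conj_eq_iff_im.2 hw, conj_I, conj_ofReal]
      push_cast
      ring
    rw [norm_smul, e, hnorm, abs_neg, abs_of_pos (by positivity)]
    calc r / 8 * ‖R'‖ ≤ r / 8 * (2 / (r / 2)) := by gcongr
      _ = 1 / 2 := by field_simp; norm_num
      _ < 1 := by norm_num
  · exact h.exists_resolvent_of_im_ne_zero hw

theorem exists_resolvent_eq_diffQuot (w : h.domain) :
    ∃ T : h.HerglotzSpace →L[ℂ] h.HerglotzSpace, IsResolventAt h.baseExtension w T ∧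
      ∀ f : h.HerglotzSpace, ⇑(T f) = h.diffQuot w f := by
  obtain ⟨T, hT⟩ := h.exists_resolvent w
  exact ⟨T, hT, fun f => h.eq_diffQuot (h.differentiableOn_zeroExtend f) (h.sub_mul_resolvent hT f)⟩

/-- Where the resolvent of `A_h` exists, it provides the analytic continuation of `h`, since
`(h(v) - h(z)) / (v - z)` is the value at `v` of `K_v - (conj v - z) (A_h - z)⁻¹ K_v`. -/
theorem resolventSet_baseExtension : resolventSet h.baseExtension = h.domain := by
  refine Set.Subset.antisymm ?_ fun w hw => h.exists_resolvent ⟨w, hw⟩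
  rintro w ⟨T, hT⟩
  obtain ⟨R, hRa, hR⟩ := hT.exists_analyticAt
  by_cases hw : w.im = 0
  swap
  · exact h.mem_domain_of_im_ne_zero hw
  have hI : I ∈ h.domain := h.mem_domain_of_im_ne_zero (by simp)
  set v : h.domain := ⟨I, hI⟩
  refine ⟨fun z => h.extension v - (v - z) * (h.kerVec v v - (conj (v : ℂ) - z) *
    h.evalCLM v (R z (h.kerVec v))), ?_, ?_⟩
  · have h1 : AnalyticAt ℂ (fun z => h.evalCLM v (R z (h.kerVec v))) w := by
      have h2 : AnalyticAt ℂ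
          (fun z => ContinuousLinearMap.apply ℂ h.HerglotzSpace (h.kerVec v) (R z)) w :=
        (ContinuousLinearMap.analyticAt _ _).comp hRa
      exact (ContinuousLinearMap.analyticAt (h.evalCLM v) _).comp h2
    exact analyticAt_const.sub ((analyticAt_const.sub analyticAt_id).mul (analyticAt_const.sub
      ((analyticAt_const.sub analyticAt_id).mul h1)))
  · have hne : ∀ᶠ z in 𝓝 w, z ≠ I := by
      apply isOpen_ne.eventually_mem
      rintro rfl
      simp at hw
    filter_upwards [hR, hne] with z hz hzI him
    have hzd := h.mem_domain_of_im_ne_zero him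
    have hvz : (v : ℂ) - z ≠ 0 := sub_ne_zero.2 (Ne.symm hzI)
    have e1 := h.sub_mul_resolvent (w := ⟨z, hzd⟩) hz (h.kerVec v) v
    have e2 := h.extension_sub_eq (ζ := ⟨z, hzd⟩) (w := v)
    have e3 := h.extension_sub_eq (ζ := v) (w := v)
    rw [h.evalCLM_apply, ← h.extension_of_im_ne_zero him]
    rw [h.kerVec_apply v ⟨z, hzd⟩, h.kerVec_apply v v] at e1
    rw [h.kerVec_apply]
    simp only at e1 e2
    linear_combination (conj (v : ℂ) - z) * e1 + e3 - e2

/-! ### Regular extensions and the functions of `M(h)` -/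

/-- The linear relation of all pairs `(f, g')` in `L(h)` such that `g'(ζ) - ζ f(ζ)` is a multiple
of the given function `g`. For `g = 1` this is `A_h`. -/
def multipleExtension (g : h.domain → ℂ) : Submodule ℂ (h.HerglotzSpace × h.HerglotzSpace) where
  carrier := {p | ∃ c : ℂ, ∀ ζ : h.domain, p.2 ζ - ζ * p.1 ζ = c * g ζ}
  zero_mem' := ⟨0, by intro ζ; simp⟩
  add_mem' := by
    rintro p q ⟨c, hp⟩ ⟨d, hq⟩
    refine ⟨c + d, fun ζ => ?_⟩
    simp only [Prod.fst_add, Prod.snd_add, RKHS.coe_add, Pi.add_apply]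
    linear_combination hp ζ + hq ζ
  smul_mem' := by
    rintro a p ⟨c, hp⟩
    refine ⟨a * c, fun ζ => ?_⟩
    simp only [Prod.smul_fst, Prod.smul_snd, RKHS.coe_smul, Pi.smul_apply, smul_eq_mul]
    linear_combination a * hp ζ

theorem multiplication_le_multipleExtension (g : h.domain → ℂ) :
    h.multiplication ≤ h.multipleExtension g := by
  intro p hp
  refine ⟨0, fun ζ => ?_⟩
  rw [hp ζ]
  ring

theorem multiplication_le_baseExtension : h.multiplication ≤ h.baseExtension := by
  intro p hp
  refine ⟨0, fun ζ => ?_⟩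
  rw [hp ζ]
  ring

/-- If `y(ζ) - (ζ - w) x(ζ) = c g(ζ)`, evaluation at `w` gives `c = y(w) / g(w)`, and solving for
`x` gives the resolvent formula. -/
theorem hasResolventFormula_multipleExtension {g : h.domain → ℂ} (hg : g ∈ h.funcSpaceM) :
    h.HasResolventFormula (h.multipleExtension g) g := by
  intro w hgw
  obtain ⟨T, hT, hTf⟩ := h.exists_resolvent_eq_diffQuot w
  obtain ⟨F, hF⟩ := hg.2 w
  let R : h.HerglotzSpace →L[ℂ] h.HerglotzSpace := T - (h.evalCLM w).smulRight ((g w)⁻¹ • F)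
  have hR : ∀ f, R f = T f - (f w / g w) • F := by
    intro f
    change T f - h.evalCLM w f • (g w)⁻¹ • F = _
    rw [h.evalCLM_apply, smul_smul, div_eq_mul_inv]
  have hRmul : ∀ f ζ, (ζ - w) * R f ζ = f ζ - f w / g w * g ζ := by
    intro f ζ
    have h1 := h.sub_mul_resolvent hT f ζ
    have h2 := h.sub_mul_diffQuot w g ζ
    rw [← hF] at h2
    rw [hR]
    simp only [RKHS.coe_sub, RKHS.coe_smul, Pi.sub_apply, Pi.smul_apply, smul_eq_mul]
    have h3 : f w / g w * g w = f w := div_mul_cancel₀ _ hgw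
    linear_combination h1 - (f w / g w) * h2 + h3
  refine ⟨R, ?_, fun f => ?_⟩
  · rw [isResolventAt_iff]
    intro x y
    constructor
    · rintro ⟨c, hc⟩
      simp only [RKHS.coe_add, RKHS.coe_smul, Pi.add_apply, Pi.smul_apply, smul_eq_mul] at hc
      have hcw : y w / g w = c := by
        rw [div_eq_iff hgw]
        linear_combination hc w
      refine h.eq_of_forall_ne w fun ζ hζ => ?_
      have h0 : (ζ : ℂ) - w ≠ 0 := sub_ne_zero.2 fun h1 => hζ (Subtype.ext h1)
      apply mul_left_cancel₀ h0
      rw [hRmul, hcw]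
      linear_combination -hc ζ
    · rintro rfl
      refine ⟨y w / g w, fun ζ => ?_⟩
      simp only [RKHS.coe_add, RKHS.coe_smul, Pi.add_apply, Pi.smul_apply, smul_eq_mul]
      linear_combination -hRmul y ζ
  · rw [hR, RKHS.coe_sub, RKHS.coe_smul, hTf, hF]

theorem isRegularExtension_multipleExtension {g : h.domain → ℂ} (hg : g ∈ h.funcSpaceM)
    (hg0 : g ≠ 0) : IsRegularExtension h.multiplication (h.multipleExtension g) := by
  obtain ⟨w, hw⟩ := Function.ne_iff.1 hg0
  obtain ⟨T, hT, -⟩ := h.hasResolventFormula_multipleExtension hg w hw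
  exact ⟨hT.isClosed, ⟨w, T, hT⟩, h.multiplication_le_multipleExtension g⟩

/-- The resolvent formula with a nonzero `g` determines the relation. -/
theorem eq_of_hasResolventFormula {g : h.domain → ℂ} (hg0 : g ≠ 0)
    {A B : Submodule ℂ (h.HerglotzSpace × h.HerglotzSpace)} (hA : h.HasResolventFormula A g)
    (hB : h.HasResolventFormula B g) : A = B := by
  obtain ⟨w, hw⟩ := Function.ne_iff.1 hg0
  obtain ⟨T, hT, hTf⟩ := hA w hw
  obtain ⟨T', hT', hTf'⟩ := hB w hw
  have e : T = T' := by
    ext1 f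
    exact DFunLike.coe_injective ((hTf f).trans (hTf' f).symm)
  subst e
  exact hT.relation_unique hT'

/-- For `φ ∈ L(h)`, the function `1 + (ζ - w) φ(ζ)` takes the value `1` at `w` and has there the
difference quotient `φ`. -/
noncomputable def affineFunc (w : ℂ) (φ : h.HerglotzSpace) : h.domain → ℂ :=
  fun ζ => 1 + (ζ - w) * φ ζ

theorem differentiableOn_affineFunc (w : ℂ) (φ : h.HerglotzSpace) :
    DifferentiableOn ℂ (h.zeroExtend (h.affineFunc w φ)) h.domain := by
  have h1 : DifferentiableOn ℂ (fun ζ => 1 + (ζ - w) * h.zeroExtend φ ζ) h.domain :=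
    (differentiableOn_const _).add (DifferentiableOn.mul (by fun_prop)
      (h.differentiableOn_zeroExtend φ))
  refine h1.congr fun ζ hζ => ?_
  simp only [h.zeroExtend_of_mem _ hζ, affineFunc]

theorem affineFunc_mem_funcSpaceM (w : ℂ) (φ : h.HerglotzSpace) :
    h.affineFunc w φ ∈ h.funcSpaceM := by
  refine ⟨(h.differentiableOn_affineFunc w φ).analyticOnNhd h.isOpen_domain, fun v => ?_⟩
  obtain ⟨T, hT⟩ := h.exists_resolvent v
  refine ⟨φ + (v - w) • T φ, h.eq_diffQuot (h.differentiableOn_affineFunc w φ) fun ζ => ?_⟩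
  have := h.sub_mul_resolvent hT φ ζ
  simp only [RKHS.coe_add, RKHS.coe_smul, Pi.add_apply, Pi.smul_apply, smul_eq_mul, affineFunc]
  linear_combination (v - w) * this

/-- The resolvents at `w` of `A_h` and of a regular extension of `S_h` agree on the functions
vanishing at `w`, that is, they differ by an operator of rank one factoring through the evaluation
at `w`. -/
theorem exists_resolvent_eq_sub {B : Submodule ℂ (h.HerglotzSpace × h.HerglotzSpace)}
    (hB : h.multiplication ≤ B) {w : h.domain} {T R : h.HerglotzSpace →L[ℂ] h.HerglotzSpace}
    (hT : IsResolventAt h.baseExtension w T) (hR : IsResolventAt B w R) :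
    ∃ φ : h.HerglotzSpace, ∀ f, R f = T f - f w • φ := by
  have hker : ∀ f : h.HerglotzSpace, f w = 0 → R f = T f := by
    intro f hf
    have hmem : (T f, f + (w : ℂ) • T f) ∈ h.multiplication := by
      intro ζ
      have := h.sub_mul_resolvent hT f ζ
      simp only [RKHS.coe_add, RKHS.coe_smul, Pi.add_apply, Pi.smul_apply, smul_eq_mul]
      linear_combination hf - this
    exact ((isResolventAt_iff.1 hR _ _).1 (hB hmem)).symm
  by_cases hex : ∃ u : h.HerglotzSpace, u w ≠ 0
  · obtain ⟨u, hu⟩ := hex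
    refine ⟨(u w)⁻¹ • (T u - R u), fun f => ?_⟩
    have := hker (f - (f w / u w) • u) (by
      simp only [RKHS.coe_sub, RKHS.coe_smul, Pi.sub_apply, Pi.smul_apply, smul_eq_mul]
      rw [div_mul_cancel₀ _ hu, sub_self])
    rw [map_sub, map_sub, map_smul, map_smul, sub_eq_iff_eq_add] at this
    rw [this, div_eq_mul_inv]
    module
  · push Not at hex
    exact ⟨0, fun f => by rw [hker f (hex f), smul_zero, sub_zero]⟩

theorem exists_eq_multipleExtension {B : Submodule ℂ (h.HerglotzSpace × h.HerglotzSpace)}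
    (hB : IsRegularExtension h.multiplication B) :
    ∃ g ∈ h.funcSpaceM, g ≠ 0 ∧ B = h.multipleExtension g := by
  -- the resolvent set is open, so it contains a nonreal point
  obtain ⟨w₀, hw₀⟩ := hB.nonempty
  have := neBot_nonreal w₀
  obtain ⟨w, ⟨R, hR⟩, him⟩ :=
    ((((isOpen_resolventSet B).eventually_mem hw₀).filter_mono
      (nhdsWithin_le_nhds (s := {z : ℂ | z.im ≠ 0}))).and self_mem_nhdsWithin).exists
  have him : w.im ≠ 0 := him
  obtain ⟨v, rfl⟩ : ∃ v : h.domain, (v : ℂ) = w := ⟨⟨w, h.mem_domain_of_im_ne_zero him⟩, rfl⟩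
  obtain ⟨T, hT, hTf⟩ := h.exists_resolvent_eq_diffQuot v
  obtain ⟨φ, hφ⟩ := h.exists_resolvent_eq_sub hB.le hT hR
  have hgv : h.affineFunc v φ v = 1 := by simp [affineFunc]
  have hM := h.affineFunc_mem_funcSpaceM v φ
  refine ⟨h.affineFunc v φ, hM, fun h0 => ?_, ?_⟩
  · rw [h0] at hgv
    exact zero_ne_one hgv
  · obtain ⟨R', hR', hR'f⟩ := h.hasResolventFormula_multipleExtension hM v (by simp [hgv])
    have hφg : ⇑φ = h.diffQuot v (h.affineFunc v φ) :=
      h.eq_diffQuot (h.differentiableOn_affineFunc v φ) fun ζ => by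
        rw [hgv, affineFunc]
        ring
    have e : R = R' := by
      ext1 f
      refine DFunLike.coe_injective ?_
      rw [hR'f, hφ, RKHS.coe_sub, RKHS.coe_smul, hTf, ← hφg, hgv, div_one]
    subst e
    exact hR.relation_unique hR'

end HerglotzNevanlinna

theorem mainTheorem3 (h : HerglotzNevanlinna) :
    (h.multiplication ≤ h.baseExtension ∧
      h.baseExtension.adjoint = h.baseExtension ∧
      LinearRelation.resolventSet h.baseExtension = h.domain ∧
      ∀ w : h.domain, ∃ T : h.HerglotzSpace →L[ℂ] h.HerglotzSpace,
        LinearRelation.IsResolventAt h.baseExtension w T ∧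
        ∀ f : h.HerglotzSpace, ⇑(T f) = h.diffQuot w f) ∧
    (∀ g ∈ h.funcSpaceM, g ≠ 0 →
      ∃! B : Submodule ℂ (h.HerglotzSpace × h.HerglotzSpace),
        LinearRelation.IsRegularExtension h.multiplication B ∧ h.HasResolventFormula B g) ∧
    (∀ B : Submodule ℂ (h.HerglotzSpace × h.HerglotzSpace),
      LinearRelation.IsRegularExtension h.multiplication B →
      ∃ g ∈ h.funcSpaceM, g ≠ 0 ∧ h.HasResolventFormula B g) := by
  refine ⟨⟨h.multiplication_le_baseExtension, h.adjoint_baseExtension,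
    h.resolventSet_baseExtension, h.exists_resolvent_eq_diffQuot⟩, fun g hg hg0 => ?_,
    fun B hB => ?_⟩
  · have hg' := h.hasResolventFormula_multipleExtension hg
    exact ⟨h.multipleExtension g, ⟨h.isRegularExtension_multipleExtension hg hg0, hg'⟩,
      fun B hB => h.eq_of_hasResolventFormula hg0 hB.2 hg'⟩
  · obtain ⟨g, hg, hg0, rfl⟩ := h.exists_eq_multipleExtension hB
    exact ⟨g, hg, hg0, h.hasResolventFormula_multipleExtension hg⟩
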